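/- Let $\beta,\gamma,\epsilon,\beta_n,\gamma_n$ ($n\ge 3$) be real constants and, for a mass parameter $m=GM/c^2>0$, consider the static isotropic metric $ds^2=\mathcal A(r)(dx^0)^2-\mathcal B^{-1}(r)\,\delta_{ij}dx^idx^j$, $r=|\boldsymbol x|$, with $$\mathcal A(r)=1-\frac{2m}{r}+2\beta\frac{m^2}{r^2}+\sum_{n\ge 3}\frac{(-1)^n n}{2^{n-2}}\beta_n\frac{m^n}{r^n},$$ $$\mathcal B^{-1}(r)=1+2\gamma\frac mr+\tfrac32\epsilon\frac{m^2}{r^2}+\tfrac12\gamma_3\frac{m^3}{r^3}+\tfrac1{16}\gamma_4\frac{m^4}{r^4}+\sum_{n\ge5}(\gamma_n-1)\frac{m^n}{r^n}.$$ Assume that for the actual value $m_0>0$ of $m$ both series converge and are positive for all $r>r_h$, where $r_h>0$. Put $\kappa=2(1+\gamma)-\beta+\frac34\epsilon$ and $\kappa_3=2\kappa-2\beta(1+\gamma)+\frac34\beta_3+\frac14\gamma_3$. Let $\boldsymbol x_A,\boldsymbol x_B\in\mathbb R^3$ be such that $|\boldsymbol x_A+\xi(\boldsymbol x_B-\boldsymbol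 x_A)|>r_h$ for $0\le\xi\le1$, put $\boldsymbol n_A=\boldsymbol x_A/|\boldsymbol x_A|$, $\boldsymbol n_B=\boldsymbol x_B/|\boldsymbol x_B|$, $\boldsymbol N_{AB}=(\boldsymbol x_B-\boldsymbol x_A)/|\boldsymbol x_B-\boldsymbol x_A|$, and assume $\boldsymbol n_A\ne\boldsymbol n_B$. Consider a quasi-Minkowskian light ray joining $\boldsymbol x_A$ and $\boldsymbol x_B$: for all small $m>0$, a null geodesic of $ds^2$ (or of the conformal metric $\mathcal A^{-1}ds^2$) confined in the region $r>r_h$, with affine parameter $\xi\in[0,1]$, given by series in powers of $m$, differentiable term by term in $\xi$, $$x^0=ct_A+\xi|\boldsymbol x_B-\boldsymbol x_A|+\sum_{n\ge1}X^0_{(n)}(\xi),\qquad \boldsymbol x=\boldsymbol x_A+\xi(\boldsymbol x_B-\boldsymbol x_A)+\sum_{n\ge1}\boldsymbol X_{(n)}(\xi),$$ where $X^0_{(n)},\boldsymbol X_{(n)}$ are proportional to $m^n$, $X^0_{(n)}(0)=0$ and $\boldsymbol X_{(n)}(0)=\boldsymbol X_{(n)}(1)=0$. Let $b=J/E$ be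 its impact parameter, where $E=l_0$ and $J=|l_\varphi|$ are the conserved quantities formed from the covariant components $l_\alpha$ of the tangent vector ($\varphi$ being the azimuth in the plane of the ray). Let $r_c=\frac{|\boldsymbol x_A||\boldsymbol x_B|}{|\boldsymbol x_B-\boldsymbol x_A|}|\boldsymbol n_A\times\boldsymbol n_B|$ be the Euclidean distance from the origin to the line through $\boldsymbol x_A$ and $\boldsymbol x_B$. Then, for all sufficiently small $m>0$, $b$ is given by a convergent series $$b=r_c\Big[1+\sum_{n\ge1}\Big(\frac m{r_c}\Big)^n q_n\Big],$$ with coefficients $q_n$ independent of $m$, and $$q_1=(1+\gamma)\frac{|\boldsymbol N_{AB}\times\boldsymbol n_A|+|\boldsymbol N_{AB}\times\boldsymbol n_B|}{1+\boldsymbol n_A\cdot\boldsymbol n_B},$$ $$q_2=\kappa\Big[1-\frac{(\boldsymbol N_{AB}\cdot\boldsymbol n_A)(\boldsymbol N_{AB}\cdot\boldsymbol n_B)}{|\boldsymbol n_A\times\boldsymbol n_B|}\arccos(\boldsymbol n_A\cdot\boldsymbol n_B)\Big]-(1+\gamma)^2\,\frac{1-(\boldsymbol N_{AB}\cdot\boldsymbol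 n_A)(\boldsymbol N_{AB}\cdot\boldsymbol n_B)}{1+\boldsymbol n_A\cdot\boldsymbol n_B},$$ $$q_3=\frac{|\boldsymbol N_{AB}\times\boldsymbol n_A|+|\boldsymbol N_{AB}\times\boldsymbol n_B|}{1+\boldsymbol n_A\cdot\boldsymbol n_B}\Big\{\kappa_3\big[1-(\boldsymbol N_{AB}\cdot\boldsymbol n_A)(\boldsymbol N_{AB}\cdot\boldsymbol n_B)\big]$$ $$-(1+\gamma)\kappa\Big[1+\frac{1-\boldsymbol n_A\cdot\boldsymbol n_B-(\boldsymbol N_{AB}\cdot\boldsymbol n_A)(\boldsymbol N_{AB}\cdot\boldsymbol n_B)}{|\boldsymbol n_A\times\boldsymbol n_B|}\arccos(\boldsymbol n_A\cdot\boldsymbol n_B)\Big]$$ $$+(1+\gamma)^3\,\frac{2-\boldsymbol n_A\cdot\boldsymbol n_B-(\boldsymbol N_{AB}\cdot\boldsymbol n_A)(\boldsymbol N_{AB}\cdot\boldsymbol n_B)}{1+\boldsymbol n_A\cdot\boldsymbol n_B}\Big\}.$$ -/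

import Mathlib

open Set Filter Topology

noncomputable section

namespace LightRay

/-- Euclidean 3-vectors (triples of isotropic quasi-Cartesian space coordinates). -/
abbrev E3 : Type := EuclideanSpace ℝ (Fin 3)

/-- Coordinates `(x⁰, x)` of an event, and components of a tangent vector. -/
abbrev Event : Type := ℝ × E3

/-- The Euclidean cross product. -/
def cross (a b : E3) : E3 := WithLp.toLp 2 (crossProduct (WithLp.ofLp a) (WithLp.ofLp b))

/-- The Euclidean unit vector `x / |x|`. -/
def dir (x : E3) : E3 := ‖x‖⁻¹ • x

/-- Generalized post-Newtonian parameters `β, γ, ε, βₙ, γₙ`. Only the values `βs n`, `γs n` with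
`n ≥ 3` are used. -/
structure Params where
  β : ℝ
  γ : ℝ
  ε : ℝ
  βs : ℕ → ℝ
  γs : ℕ → ℝ

/-- Coefficient of `(m/r)ⁿ` in `𝒜(r)`; for `n = 3, 4` the general formula gives `-(3/2) β₃`
and `β₄`. -/
def Params.coeffA (p : Params) : ℕ → ℝ
  | 0 => 1
  | 1 => -2
  | 2 => 2 * p.β
  | n + 3 => (-1 : ℝ) ^ (n + 3) * ((n : ℝ) + 3) / 2 ^ (n + 1) * p.βs (n + 3)

/-- Coefficient of `(m/r)ⁿ` in `ℬ⁻¹(r)`. -/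
def Params.coeffB (p : Params) : ℕ → ℝ
  | 0 => 1
  | 1 => 2 * p.γ
  | 2 => 3 / 2 * p.ε
  | 3 => 1 / 2 * p.γs 3
  | 4 => 1 / 16 * p.γs 4
  | n + 5 => p.γs (n + 5) - 1

/-- The potential `𝒜(r)` of a body of mass parameter `m = GM/c²`. -/
def Params.potA (p : Params) (m r : ℝ) : ℝ := ∑' n, p.coeffA n * (m / r) ^ n

/-- The potential `ℬ⁻¹(r)` of a body of mass parameter `m = GM/c²`. -/
def Params.potBinv (p : Params) (m r : ℝ) : ℝ := ∑' n, p.coeffB n * (m / r) ^ n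

/-- `κ = 2(1+γ) - β + (3/4) ε`. -/
def Params.kappa (p : Params) : ℝ := 2 * (1 + p.γ) - p.β + 3 / 4 * p.ε

/-- `κ₃ = 2κ - 2β(1+γ) + (3/4) β₃ + (1/4) γ₃`. -/
def Params.kappa3 (p : Params) : ℝ :=
  2 * p.kappa - 2 * p.β * (1 + p.γ) + 3 / 4 * p.βs 3 + 1 / 4 * p.γs 3

/-- A metric in coordinates: `g X v w` is the value of the metric at the event `X` on the tangent
vectors `v`, `w`. -/
abbrev Metric4 : Type := Event → Event → Event → ℝ

/-- The static isotropic metric `P(r) (dx⁰)² - Q(r) δᵢⱼ dxⁱ dxʲ`, `r = |x|`. -/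
def isotropicMetric (P Q : ℝ → ℝ) : Metric4 := fun X v w =>
  P ‖X.2‖ * (v.1 * w.1) - Q ‖X.2‖ * inner ℝ v.2 w.2

/-- The spacetime metric `ds² = 𝒜(r) (dx⁰)² - ℬ⁻¹(r) δᵢⱼ dxⁱ dxʲ`, for the mass parameter `m`. -/
def Params.metric (p : Params) (m : ℝ) : Metric4 := isotropicMetric (p.potA m) (p.potBinv m)

/-- The conformal metric `𝒜⁻¹(r) ds² = (dx⁰)² - 𝒰(r) δᵢⱼ dxⁱ dxʲ`, `𝒰 = 1/(𝒜ℬ)`. -/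
def Params.conformalMetric (p : Params) (m : ℝ) : Metric4 :=
  isotropicMetric (fun _ => 1) (fun r => p.potBinv m r / p.potA m r)

/-- `Γ` restricted to `s` is an affinely parametrized null geodesic of the metric `g`: with
`l_α = g_{αβ} dx^β/dξ`, the geodesic equations are `dl_α/dξ = (1/2) (∂_α g_{βσ}) (dx^β/dξ)(dx^σ/dξ)`
(here contracted with an arbitrary constant vector `w`). -/
def IsNullGeodesicOn (g : Metric4) (Γ : ℝ → Event) (s : Set ℝ) : Prop :=
  ∀ ξ ∈ s, DifferentiableWithinAt ℝ Γ s ξ ∧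
    g (Γ ξ) (derivWithin Γ s ξ) (derivWithin Γ s ξ) = 0 ∧
    ∀ w : Event,
      HasDerivWithinAt (fun t => g (Γ t) (derivWithin Γ s t) w)
        (1 / 2 * fderiv ℝ (fun X => g X (derivWithin Γ s ξ) (derivWithin Γ s ξ)) (Γ ξ) w) s ξ

/-- The covariant time component `l₀` of the tangent vector, at the parameter value `ξ ∈ [0,1]`. -/
def covTime (g : Metric4) (Γ : ℝ → Event) (ξ : ℝ) : ℝ :=
  g (Γ ξ) (derivWithin Γ (Icc 0 1) ξ) (1, 0)

/-- The covariant space components `l_i` of the tangent vector, at the parameter value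
`ξ ∈ [0,1]`. -/
def covSpace (g : Metric4) (Γ : ℝ → Event) (ξ : ℝ) : E3 :=
  WithLp.toLp 2 fun i => g (Γ ξ) (derivWithin Γ (Icc 0 1) ξ) (0, EuclideanSpace.single i 1)

/-- The impact parameter `b = J/E`, where `E = l₀` and `J = |l_φ| = |x × l|` (the modulus of the
covariant component along the rotation field about the normal to the orbital plane), evaluated at
the parameter value `ξ ∈ [0,1]`. -/
def impactParameter (g : Metric4) (Γ : ℝ → Event) (ξ : ℝ) : ℝ :=
  ‖cross (Γ ξ).2 (covSpace g Γ ξ)‖ / covTime g Γ ξ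

/-- `Γ m` is, for all sufficiently small values `m > 0` of the mass parameter, a light ray of `g m`
from `xA` (at `x⁰ = x0A`) to `xB`, confined in the region `r > rh` and given by a series in powers
of `m` (with coefficients `Y n`) whose term of order zero is the Minkowskian null segment; the
series can be differentiated term by term in the affine parameter `ξ ∈ [0,1]`. -/
def IsQuasiMinkowskianRay (g : ℝ → Metric4) (rh x0A : ℝ) (xA xB : E3) (Γ : ℝ → ℝ → Event) :
    Prop :=
  ∃ ρ > 0, ∃ Y : ℕ → ℝ → Event,
    (∀ ξ ∈ Icc (0 : ℝ) 1, Y 0 ξ = (x0A + ξ * ‖xB - xA‖, xA + ξ • (xB - xA))) ∧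
    (∀ n ≥ 1, Y n 0 = 0 ∧ (Y n 1).2 = 0) ∧
    (∀ n, DifferentiableOn ℝ (Y n) (Icc 0 1)) ∧
    ∀ m ∈ Ioo 0 ρ,
      (∀ ξ ∈ Icc (0 : ℝ) 1,
        HasSum (fun n => m ^ n • Y n ξ) (Γ m ξ) ∧
        HasSum (fun n => m ^ n • derivWithin (Y n) (Icc 0 1) ξ) (derivWithin (Γ m) (Icc 0 1) ξ) ∧
        rh < ‖(Γ m ξ).2‖) ∧
      IsNullGeodesicOn (g m) (Γ m) (Icc 0 1)

/-- The distance `r_c` from the origin to the straight line through `xA` and `xB`. -/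
def rc (xA xB : E3) : ℝ := ‖xA‖ * ‖xB‖ / ‖xB - xA‖ * ‖cross (dir xA) (dir xB)‖

end LightRay

end

namespace LightRay

/-! ### Power series in one variable and their truncations at order three. -/

open Asymptotics

/-! After division by the conserved energy, a null geodesic of either metric is a ray of a medium of
squared refractive index `V(m/r)`, where `V(x) = 1 + 2(1+γ)x + 2κx² + 2κ₃x³ + O(x⁴)`. The force is
central, so the ray stays in a plane through the origin. Write `d` for `r_c`, `u = 1/r`, and `θ` for
the polar angle measured from the perpendicular to the line of the end points. The momentum
multiplied by `b`, with components `(P, K)`, satisfies `P cos θ - K sin θ = b² u`, `dP = -m w sin θ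
dθ` and `dK = -m w cos θ dθ`, with `w = V'(m u)/2`.

Projecting on the transverse direction at the far end gives `b² cos θB / d - (P(0) cos θB - K(0) sin
θB) = m ∫ w sin (θB - θ) dθ`. Modulo `m⁴` this needs `w` modulo `m³`, hence `u` modulo `m²`. The
latter is the linear Binet problem with both end values prescribed (`AngularFamily.order_u_sub`), so
the right side becomes explicit (`AngularFamily.order_transfer`). At the near end the transverse
momentum and the length of the momentum are known exactly. Eliminating `P(0)` and `K(0)` leaves a
quadratic equation for `(b/d)²` modulo `m⁴` (`AngularFamily.order_quadratic`), solved by iteration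
in `AngularFamily.expand_sq`.

The quantity `b` is analytic in `m` beforehand: it is conserved, so it can be computed from the
tangent vector at `ξ = 0`, whose components are power series in `m`
(`IsQuasiMinkowskianRay.initial`). Its first coefficients are therefore determined by the expansion
of `b²` (`eq_of_sq_expansion`), and trigonometry brings them to the stated form
(`impact_coeff_of_bend`).

No integral is formed. Explicit antiderivatives and the mean value inequality
(`hasOrder_sub_of_deriv`) give estimates uniform along the ray from the equations of motion, so the
series of the ray need not converge uniformly in `ξ`. -/

theorem hasFPowerSeriesOnBall_tsum_mul_pow {c : ℕ → ℝ} {x₀ : ℝ} (hx₀ : 0 < x₀)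
    (h : Summable fun n => c n * x₀ ^ n) :
    HasFPowerSeriesOnBall (fun x => ∑' n, c n * x ^ n) (FormalMultilinearSeries.ofScalars ℝ c) 0
      (ENNReal.ofReal x₀) := by
  have hr : ENNReal.ofReal x₀ ≤ (FormalMultilinearSeries.ofScalars ℝ c).radius := by
    refine FormalMultilinearSeries.le_radius_of_tendsto (l := 0) _ ?_
    have := h.tendsto_atTop_zero.norm
    simpa [FormalMultilinearSeries.ofScalars_norm, abs_of_pos hx₀, Real.coe_toNNReal _ hx₀.le]
      using this
  have hpos : 0 < ENNReal.ofReal x₀ := by simpa using hx₀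
  have h1 := ((FormalMultilinearSeries.ofScalars ℝ c).hasFPowerSeriesOnBall
    (hpos.trans_le hr)).mono hpos hr
  convert h1 using 2 with x
  simp [FormalMultilinearSeries.sum, mul_comm]

theorem analyticAt_tsum_mul_pow {c : ℕ → ℝ} {x₀ : ℝ} (hx₀ : 0 < x₀)
    (h : Summable fun n => c n * x₀ ^ n) : AnalyticAt ℝ (fun x => ∑' n, c n * x ^ n) 0 :=
  (hasFPowerSeriesOnBall_tsum_mul_pow hx₀ h).analyticAt

theorem eventually_summable_mul_pow {c : ℕ → ℝ} {x₀ : ℝ} (hx₀ : 0 < x₀)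
    (h : Summable fun n => c n * x₀ ^ n) : ∀ᶠ x in 𝓝 (0 : ℝ), Summable fun n => c n * x ^ n := by
  have hb := hasFPowerSeriesOnBall_tsum_mul_pow hx₀ h
  filter_upwards [Metric.eball_mem_nhds (0 : ℝ) hb.r_pos] with x hx
  have := (hb.hasSum hx).summable
  simpa [FormalMultilinearSeries.ofScalars_apply_eq, mul_comm] using this

/-- The remainder is kept as `x⁴` times an analytic function, not as a bare `O(x⁴)`, so that it can
be differentiated later. -/
theorem exists_cubic_remainder_tsum {c : ℕ → ℝ} {x₀ : ℝ} (hx₀ : 0 < x₀)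
    (h : Summable fun n => c n * x₀ ^ n) :
    ∃ R : ℝ → ℝ, AnalyticAt ℝ R 0 ∧ ∀ᶠ x in 𝓝 (0 : ℝ),
      ∑' n, c n * x ^ n = c 0 + c 1 * x + c 2 * x ^ 2 + c 3 * x ^ 3 + x ^ 4 * R x := by
  have h4 : Summable fun n => c (n + 4) * x₀ ^ n := by
    have := ((summable_nat_add_iff 4).2 h).mul_right ((x₀ ^ 4)⁻¹)
    refine this.congr fun n => ?_
    rw [pow_add]; field_simp
  refine ⟨_, analyticAt_tsum_mul_pow hx₀ h4, ?_⟩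
  filter_upwards [eventually_summable_mul_pow hx₀ h] with x hx
  rw [← hx.sum_add_tsum_nat_add 4, ← tsum_mul_left]
  simp only [Finset.sum_range_succ, Finset.sum_range_zero]
  congr 1
  · ring
  · exact tsum_congr fun n => by ring

theorem exists_eventually_hasSum {F : ℝ → ℝ} (hF : AnalyticAt ℝ F 0) :
    ∃ c : ℕ → ℝ, (∃ x₀ > 0, Summable fun n => c n * x₀ ^ n) ∧
      ∀ᶠ x in 𝓝 (0 : ℝ), HasSum (fun n => c n * x ^ n) (F x) := by
  obtain ⟨p, hp⟩ := hF
  have h := hp.eventually_hasSum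
  have h' : ∀ᶠ x in 𝓝 (0 : ℝ), HasSum (fun n => p.coeff n * x ^ n) (F x) := by
    filter_upwards [h] with x hx
    simpa [mul_comm] using hx
  refine ⟨fun n => p.coeff n, ?_, h'⟩
  obtain ⟨x, hx, hx0⟩ :=
    ((h'.filter_mono nhdsWithin_le_nhds).and (self_mem_nhdsWithin (s := Ioi (0 : ℝ)))).exists
  exact ⟨x, hx0, hx.summable⟩

theorem exists_cubic_remainder {F : ℝ → ℝ} (hF : AnalyticAt ℝ F 0) :
    ∃ c : ℕ → ℝ, (∀ᶠ x in 𝓝 (0 : ℝ), HasSum (fun n => c n * x ^ n) (F x)) ∧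
      (fun x => F x - (c 0 + c 1 * x + c 2 * x ^ 2 + c 3 * x ^ 3)) =O[𝓝 0] fun x => x ^ 4 := by
  obtain ⟨c, ⟨x₀, hx₀, hs⟩, hc⟩ := exists_eventually_hasSum hF
  obtain ⟨R, hR, h⟩ := exists_cubic_remainder_tsum hx₀ hs
  refine ⟨c, hc, ?_⟩
  have hO : (fun x => x ^ 4 * R x) =O[𝓝 (0 : ℝ)] fun x => x ^ 4 * 1 :=
    (isBigO_refl _ _).mul (hR.continuousAt.tendsto.isBigO_one ℝ)
  simp only [mul_one] at hO
  refine hO.congr' ?_ EventuallyEq.rfl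
  filter_upwards [hc, h] with x h1 h2
  rw [← h1.tsum_eq, h2]; ring

theorem eq_zero_of_isBigO_id {f : ℝ → ℝ} (hf : Continuous f)
    (h : f =O[𝓝[>] 0] fun x : ℝ => x) : f 0 = 0 := by
  have h1 : Tendsto f (𝓝[>] 0) (𝓝 0) :=
    h.trans_tendsto (tendsto_id.mono_left nhdsWithin_le_nhds)
  exact tendsto_nhds_unique ((hf.tendsto 0).mono_left nhdsWithin_le_nhds) h1

theorem isBigO_of_mul_id {f : ℝ → ℝ} {n : ℕ}
    (h : (fun x => x * f x) =O[𝓝[>] 0] fun x : ℝ => x ^ (n + 1)) :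
    f =O[𝓝[>] 0] fun x : ℝ => x ^ n := by
  have h2 := (isBigO_refl (fun x : ℝ => x⁻¹) (𝓝[>] 0)).mul h
  refine h2.congr' ?_ ?_ <;> filter_upwards [self_mem_nhdsWithin] with x hx
  · have : x ≠ 0 := ne_of_gt hx
    field_simp
  · have : x ≠ 0 := ne_of_gt hx
    rw [pow_succ]; field_simp

/-- The coefficients are peeled off one at a time: let `x → 0`, then divide by `x`. A one-sided
neighbourhood suffices, which matters because rays exist only for `m > 0`. -/
theorem cubic_coeff_eq_zero {c₀ c₁ c₂ c₃ : ℝ}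
    (h : (fun x : ℝ => c₀ + c₁ * x + c₂ * x ^ 2 + c₃ * x ^ 3) =O[𝓝[>] 0] fun x : ℝ => x ^ 4) :
    c₀ = 0 ∧ c₁ = 0 ∧ c₂ = 0 ∧ c₃ = 0 := by
  have hle : ∀ n : ℕ, (fun x : ℝ => x ^ (n + 1)) =O[𝓝[>] 0] fun x : ℝ => x := by
    intro n
    have h1 : (fun x : ℝ => x ^ n) =O[𝓝[>] 0] fun _ => (1 : ℝ) :=
      (((continuous_pow n).tendsto (0 : ℝ)).mono_left nhdsWithin_le_nhds).isBigO_one ℝ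
    simpa [pow_succ] using h1.mul (isBigO_refl (fun x : ℝ => x) (𝓝[>] 0))
  have e0 : c₀ = 0 := by
    simpa using eq_zero_of_isBigO_id (by fun_prop) (h.trans (hle 3))
  have h1 : (fun x : ℝ => c₁ + c₂ * x + c₃ * x ^ 2) =O[𝓝[>] 0] fun x : ℝ => x ^ 3 :=
    isBigO_of_mul_id (h.congr_left fun x => by rw [e0]; ring)
  have e1 : c₁ = 0 := by
    simpa using eq_zero_of_isBigO_id (by fun_prop) (h1.trans (hle 2))
  have h2 : (fun x : ℝ => c₂ + c₃ * x) =O[𝓝[>] 0] fun x : ℝ => x ^ 2 :=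
    isBigO_of_mul_id (h1.congr_left fun x => by rw [e1]; ring)
  have e2 : c₂ = 0 := by
    simpa using eq_zero_of_isBigO_id (by fun_prop) (h2.trans (hle 1))
  have h3 : (fun _ : ℝ => c₃) =O[𝓝[>] 0] fun x : ℝ => x ^ 1 :=
    isBigO_of_mul_id (h2.congr_left fun x => by rw [e2]; ring)
  have e3 : c₃ = 0 := by
    simpa using eq_zero_of_isBigO_id (by fun_prop) (h3.trans (hle 0))
  exact ⟨e0, e1, e2, e3⟩

/-- An order bound alone does not survive differentiation; analyticity of the cofactor makes it do
so, at the cost of one power. -/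
theorem deriv_pow_four_mul_isBigO {R : ℝ → ℝ} (hR : AnalyticAt ℝ R 0) :
    (deriv fun x => x ^ 4 * R x) =O[𝓝 0] fun x : ℝ => x ^ 3 := by
  have h1 : ∀ᶠ x in 𝓝 (0 : ℝ),
      deriv (fun x => x ^ 4 * R x) x = x ^ 3 * (4 * R x + x * deriv R x) := by
    filter_upwards [hR.eventually_analyticAt] with x hx
    have := ((hasDerivAt_pow 4 x).mul hx.differentiableAt.hasDerivAt).deriv
    simp only [Pi.mul_def] at this
    rw [this]; push_cast; ring
  have h2 : ContinuousAt (fun x => 4 * R x + x * deriv R x) 0 := by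
    have := hR.continuousAt
    have := hR.deriv.continuousAt
    fun_prop
  have h3 := (isBigO_refl (fun x : ℝ => x ^ 3) (𝓝 0)).mul (h2.tendsto.isBigO_one ℝ)
  simp only [mul_one] at h3
  exact h3.congr' (h1.mono fun x hx => hx.symm) EventuallyEq.rfl

/-! ### Expansion of the refractive index. -/

/-- `𝒰(r)` as a function of `m / r`. -/
noncomputable def Params.optical (p : Params) (x : ℝ) : ℝ :=
  (∑' n, p.coeffB n * x ^ n) / ∑' n, p.coeffA n * x ^ n

theorem Params.exists_optical_eq (p : Params) {x₀ : ℝ} (hx₀ : 0 < x₀)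
    (hA : Summable fun n => p.coeffA n * x₀ ^ n) (hB : Summable fun n => p.coeffB n * x₀ ^ n) :
    ∃ R : ℝ → ℝ, AnalyticAt ℝ R 0 ∧ ∀ᶠ x in 𝓝 (0 : ℝ), p.optical x =
      (1 + 2 * (1 + p.γ) * x + 2 * p.kappa * x ^ 2 + 2 * p.kappa3 * x ^ 3) + x ^ 4 * R x := by
  obtain ⟨RA, hRA, eA⟩ := exists_cubic_remainder_tsum hx₀ hA
  obtain ⟨RB, hRB, eB⟩ := exists_cubic_remainder_tsum hx₀ hB
  have aA := analyticAt_tsum_mul_pow hx₀ hA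
  have A0 : (∑' n, p.coeffA n * (0 : ℝ) ^ n) ≠ 0 := by
    rw [eA.self_of_nhds]; simp [Params.coeffA]
  let T : ℝ → ℝ := fun x =>
    1 + 2 * (1 + p.γ) * x + 2 * p.kappa * x ^ 2 + 2 * p.kappa3 * x ^ 3
  -- `D` collects the terms of degree at least four, divided by `x⁴`, in the product of `T` with the
  -- cubic truncation of `𝒜`. The coefficients below that degree agree with those of `ℬ⁻¹`, by the
  -- definitions of `κ` and `κ₃`.
  let D : ℝ → ℝ := fun x => p.coeffA 1 * (2 * p.kappa3) + p.coeffA 2 * (2 * p.kappa) +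
    p.coeffA 3 * (2 * (1 + p.γ)) + (p.coeffA 2 * (2 * p.kappa3) + p.coeffA 3 * (2 * p.kappa)) * x
    + p.coeffA 3 * (2 * p.kappa3) * x ^ 2
  refine ⟨fun x => (RB x - T x * RA x - D x) / ∑' n, p.coeffA n * x ^ n, ?_, ?_⟩
  · refine AnalyticAt.div ?_ aA A0
    fun_prop
  · filter_upwards [eA, eB, aA.continuousAt.eventually_ne A0] with x hxA hxB hne
    rw [Params.optical, div_eq_iff hne, add_mul, mul_assoc (x ^ 4), div_mul_cancel₀ _ hne, hxB, hxA]
    simp only [Params.coeffA, Params.coeffB, T, D, Params.kappa, Params.kappa3]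
    norm_num
    ring

theorem Params.optical_isBigO (p : Params) {x₀ : ℝ} (hx₀ : 0 < x₀)
    (hA : Summable fun n => p.coeffA n * x₀ ^ n) (hB : Summable fun n => p.coeffB n * x₀ ^ n) :
    (fun x => p.optical x - (1 + 2 * (1 + p.γ) * x + 2 * p.kappa * x ^ 2 + 2 * p.kappa3 * x ^ 3))
      =O[𝓝 0] fun x => x ^ 4 := by
  obtain ⟨R, hR, h⟩ := p.exists_optical_eq hx₀ hA hB
  have hO : (fun x => x ^ 4 * R x) =O[𝓝 (0 : ℝ)] fun x => x ^ 4 * 1 :=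
    (isBigO_refl _ _).mul (hR.continuousAt.tendsto.isBigO_one ℝ)
  simp only [mul_one] at hO
  refine hO.congr' ?_ EventuallyEq.rfl
  filter_upwards [h] with x hx
  rw [hx]; ring

theorem Params.deriv_optical_isBigO (p : Params) {x₀ : ℝ} (hx₀ : 0 < x₀)
    (hA : Summable fun n => p.coeffA n * x₀ ^ n) (hB : Summable fun n => p.coeffB n * x₀ ^ n) :
    (fun x => deriv p.optical x / 2 - (1 + p.γ + 2 * p.kappa * x + 3 * p.kappa3 * x ^ 2))
      =O[𝓝 0] fun x => x ^ 3 := by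
  obtain ⟨R, hR, h⟩ := p.exists_optical_eq hx₀ hA hB
  refine ((deriv_pow_four_mul_isBigO hR).const_mul_left (1 / 2)).congr' ?_ EventuallyEq.rfl
  filter_upwards [h.eventually_nhds, hR.eventually_analyticAt] with x hx hRx
  have e : deriv p.optical x = 2 * (1 + p.γ) + 2 * p.kappa * (2 * x) + 2 * p.kappa3 * (3 * x ^ 2)
      + deriv (fun x => x ^ 4 * R x) x := by
    rw [EventuallyEq.deriv_eq hx]
    have hd : DifferentiableAt ℝ (fun x => x ^ 4 * R x) x :=
      (differentiableAt_pow 4).mul hRx.differentiableAt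
    have := (((((hasDerivAt_id x).const_mul (2 * (1 + p.γ))).const_add 1).add
      ((hasDerivAt_pow 2 x).const_mul (2 * p.kappa))).add
      ((hasDerivAt_pow 3 x).const_mul (2 * p.kappa3))).add hd.hasDerivAt
    refine (this.congr_deriv ?_).deriv
    norm_num
  rw [e]; ring

/-! ### From null geodesics to rays of a refracting medium. -/

theorem hasFDerivAt_isotropicMetric_apply {P Q : ℝ → ℝ} {X v w : Event} (hX : X.2 ≠ 0)
    (hP : DifferentiableAt ℝ P ‖X.2‖) (hQ : DifferentiableAt ℝ Q ‖X.2‖) :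
    fderiv ℝ (fun Z => isotropicMetric P Q Z v v) X w =
      (deriv P ‖X.2‖ * (v.1 * v.1) - deriv Q ‖X.2‖ * inner ℝ v.2 v.2) *
        (inner ℝ X.2 w.2 / ‖X.2‖) := by
  have hn : HasFDerivAt (fun Z : Event => ‖Z.2‖)
      ((fderiv ℝ (fun z : E3 => ‖z‖) X.2).comp (ContinuousLinearMap.snd ℝ ℝ E3)) X := by
    have h1 : DifferentiableAt ℝ (fun z : E3 => ‖z‖) X.2 :=
      (contDiffAt_norm ℝ hX (n := 1)).differentiableAt (by norm_num)
    exact h1.hasFDerivAt.comp X hasFDerivAt_snd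
  have h1 := ((hP.hasDerivAt.comp_hasFDerivAt X hn).mul_const (v.1 * v.1)).sub
    ((hQ.hasDerivAt.comp_hasFDerivAt X hn).mul_const (inner ℝ v.2 v.2))
  have hf : fderiv ℝ (fun z : E3 => ‖z‖) X.2 w.2 = inner ℝ X.2 w.2 / ‖X.2‖ := by
    have h2 : HasFDerivAt (fun z : E3 => Real.sqrt (‖z‖ ^ 2)) _ X.2 :=
      (hasStrictFDerivAt_norm_sq X.2).hasFDerivAt.sqrt (by simpa using hX)
    have h3 : (fun z : E3 => Real.sqrt (‖z‖ ^ 2)) = fun z => ‖z‖ := by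
      funext z; exact Real.sqrt_sq (norm_nonneg z)
    rw [h3] at h2
    rw [h2.fderiv]
    simp only [Real.sqrt_sq (norm_nonneg _), smul_apply, nsmul_eq_mul,
      innerSL_apply_apply, smul_eq_mul]
    push_cast
    field_simp
  have h4 : HasFDerivAt (fun Z => isotropicMetric P Q Z v v) _ X := h1
  rw [h4.fderiv]
  simp only [sub_apply, smul_apply,
    ContinuousLinearMap.comp_apply, ContinuousLinearMap.coe_snd', hf, smul_eq_mul]
  ring

/-- Rays of the optical medium of squared refractive index `U(r)`: `x` is the position, `l` the
momentum per unit energy, and `σ` the speed of the parameter. -/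
structure IsOpticalRay (U σ : ℝ → ℝ) (x l : ℝ → E3) : Prop where
  position : ∀ ξ ∈ Icc (0 : ℝ) 1, ∀ y : E3, HasDerivWithinAt (fun t => inner ℝ (x t) y)
    (σ ξ * inner ℝ (l ξ) y) (Icc 0 1) ξ
  momentum : ∀ ξ ∈ Icc (0 : ℝ) 1, ∀ y : E3, HasDerivWithinAt (fun t => inner ℝ (l t) y)
    (σ ξ * (deriv U ‖x ξ‖ / (2 * ‖x ξ‖) * inner ℝ (x ξ) y)) (Icc 0 1) ξ
  norm_sq : ∀ ξ ∈ Icc (0 : ℝ) 1, inner ℝ (l ξ) (l ξ) = U ‖x ξ‖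

theorem eq_of_hasDerivWithinAt_zero {f : ℝ → ℝ}
    (h : ∀ ξ ∈ Icc (0 : ℝ) 1, HasDerivWithinAt f 0 (Icc 0 1) ξ) {ξ : ℝ} (hξ : ξ ∈ Icc (0 : ℝ) 1) :
    f ξ = f 0 := by
  refine constant_of_derivWithin_zero (fun t ht => (h t ht).differentiableWithinAt) ?_ ξ hξ
  intro t ht
  exact (h t ⟨ht.1, ht.2.le⟩).derivWithin (uniqueDiffOn_Icc_zero_one t ⟨ht.1, ht.2.le⟩)

theorem covTime_eq_of_isNullGeodesicOn {P Q : ℝ → ℝ} {Γ : ℝ → Event}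
    (hΓ : IsNullGeodesicOn (isotropicMetric P Q) Γ (Icc 0 1))
    (hx : ∀ ξ ∈ Icc (0 : ℝ) 1, (Γ ξ).2 ≠ 0)
    (hP : ∀ ξ ∈ Icc (0 : ℝ) 1, DifferentiableAt ℝ P ‖(Γ ξ).2‖)
    (hQ : ∀ ξ ∈ Icc (0 : ℝ) 1, DifferentiableAt ℝ Q ‖(Γ ξ).2‖) {ξ : ℝ}
    (hξ : ξ ∈ Icc (0 : ℝ) 1) :
    covTime (isotropicMetric P Q) Γ ξ = covTime (isotropicMetric P Q) Γ 0 := by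
  refine eq_of_hasDerivWithinAt_zero (f := covTime (isotropicMetric P Q) Γ) ?_ hξ
  intro t ht
  have := (hΓ t ht).2.2 (1, 0)
  rw [hasFDerivAt_isotropicMetric_apply (hx t ht) (hP t ht) (hQ t ht)] at this
  exact this.congr_deriv (by simp)

/-- On null curves the two gradient terms of the geodesic equation combine into the gradient of `Q /
P` alone. This is the conformal invariance of null geodesics, and it lets both metrics be treated at
once. -/
theorem isOpticalRay_of_isNullGeodesicOn {P Q : ℝ → ℝ} {Γ : ℝ → Event}
    (hΓ : IsNullGeodesicOn (isotropicMetric P Q) Γ (Icc 0 1))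
    (hx : ∀ ξ ∈ Icc (0 : ℝ) 1, (Γ ξ).2 ≠ 0)
    (hP : ∀ ξ ∈ Icc (0 : ℝ) 1, DifferentiableAt ℝ P ‖(Γ ξ).2‖)
    (hQ : ∀ ξ ∈ Icc (0 : ℝ) 1, DifferentiableAt ℝ Q ‖(Γ ξ).2‖)
    (hP0 : ∀ ξ ∈ Icc (0 : ℝ) 1, P ‖(Γ ξ).2‖ ≠ 0)
    (hQ0 : ∀ ξ ∈ Icc (0 : ℝ) 1, Q ‖(Γ ξ).2‖ ≠ 0)
    (hE : covTime (isotropicMetric P Q) Γ 0 ≠ 0) :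
    IsOpticalRay (fun r => Q r / P r)
      (fun ξ => covTime (isotropicMetric P Q) Γ 0 / Q ‖(Γ ξ).2‖) (fun ξ => (Γ ξ).2)
      (fun ξ => (Q ‖(Γ ξ).2‖ / covTime (isotropicMetric P Q) Γ 0) •
        (derivWithin Γ (Icc 0 1) ξ).2) := by
  have hcons := fun ξ hξ => covTime_eq_of_isNullGeodesicOn hΓ hx hP hQ (ξ := ξ) hξ
  set E := covTime (isotropicMetric P Q) Γ 0 with hEdef
  have hE1 : ∀ ξ ∈ Icc (0 : ℝ) 1, P ‖(Γ ξ).2‖ * (derivWithin Γ (Icc 0 1) ξ).1 = E := by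
    intro ξ hξ
    rw [← hcons ξ hξ]
    simp [covTime, isotropicMetric]
  have hnull : ∀ ξ ∈ Icc (0 : ℝ) 1, P ‖(Γ ξ).2‖ * ((derivWithin Γ (Icc 0 1) ξ).1 *
      (derivWithin Γ (Icc 0 1) ξ).1) = Q ‖(Γ ξ).2‖ * inner ℝ (derivWithin Γ (Icc 0 1) ξ).2
      (derivWithin Γ (Icc 0 1) ξ).2 := fun ξ hξ => sub_eq_zero.1 (hΓ ξ hξ).2.1
  refine ⟨fun ξ hξ y => ?_, fun ξ hξ y => ?_, fun ξ hξ => ?_⟩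
  · have h1 := (hΓ ξ hξ).1.hasDerivWithinAt
    have h2 : HasDerivWithinAt (fun t => (Γ t).2) (derivWithin Γ (Icc 0 1) ξ).2 (Icc 0 1) ξ :=
      h1.snd
    have h3 := h2.inner ℝ (hasDerivWithinAt_const ξ (Icc 0 1) y)
    refine h3.congr_deriv ?_
    have := hQ0 ξ hξ
    simp only [inner_zero_right, zero_add, inner_smul_left]
    simp
    field_simp
  · have h1 := (hΓ ξ hξ).2.2 (0, y)
    rw [hasFDerivAt_isotropicMetric_apply (hx ξ hξ) (hP ξ hξ) (hQ ξ hξ)] at h1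
    -- The sign compensates for the signature: the covariant space components are `-Q` times the
    -- velocity.
    have h2 := h1.const_mul (-1 / E)
    have hd : deriv (fun r => Q r / P r) ‖(Γ ξ).2‖ =
        (deriv Q ‖(Γ ξ).2‖ * P ‖(Γ ξ).2‖ - Q ‖(Γ ξ).2‖ * deriv P ‖(Γ ξ).2‖) /
          P ‖(Γ ξ).2‖ ^ 2 :=
      ((hQ ξ hξ).hasDerivAt.div (hP ξ hξ).hasDerivAt (hP0 ξ hξ)).deriv
    have hn : ‖(Γ ξ).2‖ ≠ 0 := norm_ne_zero_iff.2 (hx ξ hξ)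
    have e1 := hE1 ξ hξ
    have e2 := hnull ξ hξ
    have p0 := hP0 ξ hξ
    have q0 := hQ0 ξ hξ
    refine (h2.congr_deriv ?_).congr_of_mem (fun t ht => ?_) hξ
    · simp only [hd]
      set v := derivWithin Γ (Icc 0 1) ξ
      -- The null condition together with `P ẋ⁰ = E` fixes the Euclidean speed.
      have e3 : inner ℝ v.2 v.2 = E ^ 2 / (P ‖(Γ ξ).2‖ * Q ‖(Γ ξ).2‖) := by
        rw [eq_div_iff (mul_ne_zero p0 q0), ← e1]
        linear_combination (-P ‖(Γ ξ).2‖) * e2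
      have e4 : v.1 = E / P ‖(Γ ξ).2‖ := by rw [eq_div_iff p0, ← e1]; ring
      rw [e3, e4]
      field_simp
      ring
    · simp only [isotropicMetric, inner_smul_left]
      simp
      field_simp
  · have e1 := hE1 ξ hξ
    have e2 := hnull ξ hξ
    have p0 := hP0 ξ hξ
    have q0 := hQ0 ξ hξ
    simp only [inner_smul_left, inner_smul_right]
    simp only [RCLike.conj_to_real]
    set v := derivWithin Γ (Icc 0 1) ξ
    have e3 : inner ℝ v.2 v.2 = E ^ 2 / (P ‖(Γ ξ).2‖ * Q ‖(Γ ξ).2‖) := by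
      rw [eq_div_iff (mul_ne_zero p0 q0), ← e1]
      linear_combination (-P ‖(Γ ξ).2‖) * e2
    rw [e3]
    field_simp

/-! ### Angular momentum and planarity. -/

theorem norm_cross_sq (u v : E3) :
    ‖cross u v‖ ^ 2 = ‖u‖ ^ 2 * ‖v‖ ^ 2 - inner ℝ u v ^ 2 := by
  simp only [EuclideanSpace.norm_sq_eq, Real.norm_eq_abs, sq_abs, PiLp.inner_apply,
    Fin.sum_univ_three, cross, crossProduct, LinearMap.mk₂_apply]
  simp
  ring

theorem inner_eq_sum_frame (e : OrthonormalBasis (Fin 3) ℝ E3) (u v : E3) :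
    inner ℝ u v = inner ℝ u (e 0) * inner ℝ v (e 0) + inner ℝ u (e 1) * inner ℝ v (e 1) +
      inner ℝ u (e 2) * inner ℝ v (e 2) := by
  rw [← e.sum_inner_mul_inner u v, Fin.sum_univ_three]
  simp only [real_inner_comm v]

/-- Lagrange's identity is used in place of a component computation, so the orientation of the frame
is irrelevant. -/
theorem norm_cross_of_planar (e : OrthonormalBasis (Fin 3) ℝ E3) {u v : E3}
    (hu : inner ℝ u (e 2) = 0) (hv : inner ℝ v (e 2) = 0) :
    ‖cross u v‖ = |inner ℝ v (e 0) * inner ℝ u (e 1) - inner ℝ v (e 1) * inner ℝ u (e 0)| := by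
  rw [← abs_of_nonneg (norm_nonneg (cross u v)), ← sq_eq_sq_iff_abs_eq_abs, norm_cross_sq,
    ← real_inner_self_eq_norm_sq, ← real_inner_self_eq_norm_sq, inner_eq_sum_frame e u u,
    inner_eq_sum_frame e v v, inner_eq_sum_frame e u v, hu, hv]
  ring

/-- The force is parallel to the position and the velocity to the momentum, so every component of
the angular momentum is conserved. -/
theorem IsOpticalRay.moment_eq {U σ : ℝ → ℝ} {x l : ℝ → E3} (h : IsOpticalRay U σ x l) (y z : E3)
    {ξ : ℝ} (hξ : ξ ∈ Icc (0 : ℝ) 1) :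
    inner ℝ (l ξ) y * inner ℝ (x ξ) z - inner ℝ (l ξ) z * inner ℝ (x ξ) y =
      inner ℝ (l 0) y * inner ℝ (x 0) z - inner ℝ (l 0) z * inner ℝ (x 0) y := by
  refine eq_of_hasDerivWithinAt_zero (f := fun ξ => inner ℝ (l ξ) y * inner ℝ (x ξ) z -
    inner ℝ (l ξ) z * inner ℝ (x ξ) y) ?_ hξ
  intro t ht
  exact (((h.momentum t ht y).mul (h.position t ht z)).sub
    ((h.momentum t ht z).mul (h.position t ht y))).congr_deriv (by ring)

/-- A plane ray of the medium of squared index `U(r)`, with Cartesian coordinates `a`, `h`,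
momentum components `p`, `k` and impact parameter `b`. -/
structure IsPlaneRay (U σ a h p k : ℝ → ℝ) (b : ℝ) : Prop where
  deriv_a : ∀ ξ ∈ Icc (0 : ℝ) 1, HasDerivWithinAt a (σ ξ * p ξ) (Icc 0 1) ξ
  deriv_h : ∀ ξ ∈ Icc (0 : ℝ) 1, HasDerivWithinAt h (σ ξ * k ξ) (Icc 0 1) ξ
  deriv_p : ∀ ξ ∈ Icc (0 : ℝ) 1, HasDerivWithinAt p
    (σ ξ * (deriv U √(a ξ ^ 2 + h ξ ^ 2) / (2 * √(a ξ ^ 2 + h ξ ^ 2)) * a ξ)) (Icc 0 1) ξ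
  deriv_k : ∀ ξ ∈ Icc (0 : ℝ) 1, HasDerivWithinAt k
    (σ ξ * (deriv U √(a ξ ^ 2 + h ξ ^ 2) / (2 * √(a ξ ^ 2 + h ξ ^ 2)) * h ξ)) (Icc 0 1) ξ
  norm_sq : ∀ ξ ∈ Icc (0 : ℝ) 1, p ξ ^ 2 + k ξ ^ 2 = U √(a ξ ^ 2 + h ξ ^ 2)
  moment : ∀ ξ ∈ Icc (0 : ℝ) 1, p ξ * h ξ - k ξ * a ξ = b

/-- Both end points lie in the plane of `e 0` and `e 1`. Comparing the two off-plane angular momenta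
at the ends shows that the initial momentum lies there too, so these angular momenta vanish
throughout. -/
theorem IsOpticalRay.planar {U σ : ℝ → ℝ} {x l : ℝ → E3} (h : IsOpticalRay U σ x l)
    (e : OrthonormalBasis (Fin 3) ℝ E3) {d : ℝ} (hd : d ≠ 0)
    (h0 : inner ℝ (x 0) (e 1) = d) (h1 : inner ℝ (x 1) (e 1) = d)
    (h02 : inner ℝ (x 0) (e 2) = 0) (h12 : inner ℝ (x 1) (e 2) = 0)
    (hne : inner ℝ (x 0) (e 0) ≠ inner ℝ (x 1) (e 0))
    (hJ : inner ℝ (l 0) (e 0) * d - inner ℝ (l 0) (e 1) * inner ℝ (x 0) (e 0) ≠ 0)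
    {ξ : ℝ} (hξ : ξ ∈ Icc (0 : ℝ) 1) : inner ℝ (x ξ) (e 2) = 0 ∧ inner ℝ (l ξ) (e 2) = 0 := by
  have one : (1 : ℝ) ∈ Icc (0 : ℝ) 1 := by simp
  have m1 := h.moment_eq (e 0) (e 2) one
  have m2 := h.moment_eq (e 1) (e 2) one
  simp only [h0, h1, h02, h12] at m1 m2
  have l1 : inner ℝ (l 1) (e 2) = inner ℝ (l 0) (e 2) :=
    mul_right_cancel₀ hd (by linear_combination -m2)
  have l0 : inner ℝ (l 0) (e 2) = 0 := by
    rw [l1] at m1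
    have : inner ℝ (l 0) (e 2) * (inner ℝ (x 0) (e 0) - inner ℝ (x 1) (e 0)) = 0 := by
      linear_combination m1
    exact (mul_eq_zero.1 this).resolve_right (sub_ne_zero.2 hne)
  have n01 := h.moment_eq (e 0) (e 1) hξ
  have n02 := h.moment_eq (e 0) (e 2) hξ
  have n12 := h.moment_eq (e 1) (e 2) hξ
  rw [h0] at n01
  simp only [l0, h02, mul_zero, zero_mul, sub_zero] at n02 n12
  constructor
  -- The vanishing off-plane moments form a homogeneous linear system for the `e 2` components of
  -- `x` and `l`; its determinant is, up to sign, the in-plane angular momentum, which is nonzero.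
  · refine (mul_eq_zero.1 ?_).resolve_left hJ
    rw [← n01]
    linear_combination (inner ℝ (x ξ) (e 1)) * n02 - (inner ℝ (x ξ) (e 0)) * n12
  · refine (mul_eq_zero.1 ?_).resolve_left hJ
    rw [← n01]
    linear_combination (inner ℝ (l ξ) (e 1)) * n02 - (inner ℝ (l ξ) (e 0)) * n12

theorem IsOpticalRay.isPlaneRay {U σ : ℝ → ℝ} {x l : ℝ → E3} (h : IsOpticalRay U σ x l)
    (e : OrthonormalBasis (Fin 3) ℝ E3)
    (h2 : ∀ ξ ∈ Icc (0 : ℝ) 1, inner ℝ (x ξ) (e 2) = 0 ∧ inner ℝ (l ξ) (e 2) = 0) :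
    IsPlaneRay U σ (fun ξ => inner ℝ (x ξ) (e 0)) (fun ξ => inner ℝ (x ξ) (e 1))
      (fun ξ => inner ℝ (l ξ) (e 0)) (fun ξ => inner ℝ (l ξ) (e 1))
      (inner ℝ (l 0) (e 0) * inner ℝ (x 0) (e 1) - inner ℝ (l 0) (e 1) * inner ℝ (x 0) (e 0)) := by
  have hr : ∀ ξ ∈ Icc (0 : ℝ) 1,
      √((inner ℝ (x ξ) (e 0)) ^ 2 + (inner ℝ (x ξ) (e 1)) ^ 2) = ‖x ξ‖ := by
    intro ξ hξ
    rw [norm_eq_sqrt_real_inner, inner_eq_sum_frame e (x ξ) (x ξ), (h2 ξ hξ).1]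
    congr 1; ring
  refine ⟨fun ξ hξ => h.position ξ hξ _, fun ξ hξ => h.position ξ hξ _, fun ξ hξ => ?_,
    fun ξ hξ => ?_, fun ξ hξ => ?_, fun ξ hξ => h.moment_eq _ _ hξ⟩
  · simp only [hr ξ hξ]; exact h.momentum ξ hξ _
  · simp only [hr ξ hξ]; exact h.momentum ξ hξ _
  · simp only [hr ξ hξ]
    rw [← h.norm_sq ξ hξ, inner_eq_sum_frame e (l ξ) (l ξ), (h2 ξ hξ).2]
    ring

/-! ### Calculus of orders in the mass, uniform along the ray. -/

section Order

variable {α : Type*} {l : Filter α} {t : α → ℝ}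

/-- `f = O(tⁿ)` along the filter `l`, for a bounded scale `t`. -/
def HasOrder (l : Filter α) (t : α → ℝ) (n : ℕ) (f : α → ℝ) : Prop :=
  f =O[l] fun x => t x ^ n

theorem HasOrder.add {n : ℕ} {f f' : α → ℝ} (h : HasOrder l t n f) (h' : HasOrder l t n f') :
    HasOrder l t n fun x => f x + f' x :=
  IsBigO.add h h'

theorem HasOrder.sub {n : ℕ} {f f' : α → ℝ} (h : HasOrder l t n f) (h' : HasOrder l t n f') :
    HasOrder l t n fun x => f x - f' x :=
  IsBigO.sub h h'

theorem HasOrder.mul {n n' : ℕ} {f f' : α → ℝ} (h : HasOrder l t n f)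
    (h' : HasOrder l t n' f') : HasOrder l t (n + n') fun x => f x * f' x := by
  have := IsBigO.mul h h'
  simpa only [HasOrder, pow_add] using this

theorem HasOrder.const_mul {n : ℕ} {f : α → ℝ} (h : HasOrder l t n f) (c : ℝ) :
    HasOrder l t n fun x => c * f x :=
  IsBigO.const_mul_left h c

theorem HasOrder.congr {n : ℕ} {f f' : α → ℝ} (h : HasOrder l t n f) (e : ∀ᶠ x in l, f x = f' x) :
    HasOrder l t n f' :=
  IsBigO.congr' h e EventuallyEq.rfl

theorem HasOrder.congr_fun {n : ℕ} {f f' : α → ℝ} (h : HasOrder l t n f) (e : ∀ x, f x = f' x) :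
    HasOrder l t n f' :=
  h.congr (Eventually.of_forall e)

theorem hasOrder_scale : HasOrder l t 1 t := by
  simpa [HasOrder] using isBigO_refl t l

theorem hasOrder_const (c : ℝ) : HasOrder l t 0 fun _ => c := by
  simpa [HasOrder] using isBigO_const_const c (one_ne_zero (α := ℝ)) l

theorem hasOrder_of_le {f : α → ℝ} (C : ℝ) (h : ∀ᶠ x in l, |f x| ≤ C) : HasOrder l t 0 f := by
  refine IsBigO.of_bound C ?_
  filter_upwards [h] with x hx
  simpa using hx

theorem HasOrder.exists_bound {f : α → ℝ} (h : HasOrder l t 0 f) :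
    ∃ C, ∀ᶠ x in l, |f x| ≤ C := by
  obtain ⟨C, hC⟩ := IsBigO.bound h
  refine ⟨C, ?_⟩
  filter_upwards [hC] with x hx
  simpa using hx

theorem HasOrder.weaken (ht : Tendsto t l (𝓝 0)) {n n' : ℕ} {f : α → ℝ} (h : HasOrder l t n' f)
    (hn : n ≤ n') : HasOrder l t n f := by
  obtain ⟨j, rfl⟩ := Nat.exists_eq_add_of_le hn
  refine IsBigO.trans h ?_
  have h1 : (fun x => t x ^ j) =O[l] fun _ => (1 : ℝ) := (ht.pow j).isBigO_one ℝ
  simpa [pow_add] using (isBigO_refl (fun x => t x ^ n) l).mul h1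

theorem HasOrder.tendsto_zero (ht : Tendsto t l (𝓝 0)) {n : ℕ} {f : α → ℝ}
    (h : HasOrder l t (n + 1) f) : Tendsto f l (𝓝 0) := by
  have := HasOrder.weaken ht h (Nat.le_add_left 1 n)
  refine IsBigO.trans_tendsto this ?_
  simpa using ht

theorem HasOrder.inv {f : α → ℝ} {c : ℝ} (hc : c ≠ 0) (ht : Tendsto t l (𝓝 0))
    (h : HasOrder l t 1 fun x => f x - c) : HasOrder l t 0 fun x => (f x)⁻¹ := by
  have h1 : Tendsto f l (𝓝 c) := by
    simpa using (h.tendsto_zero (n := 0) ht).add_const c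
  have := (h1.inv₀ hc).isBigO_one ℝ
  simpa [HasOrder] using this

end Order

/-- The filter of vanishing mass parameter, uniformly in the affine parameter. -/
def rayFilter : Filter (ℝ × ℝ) := 𝓝[>] (0 : ℝ) ×ˢ 𝓟 (Icc (0 : ℝ) 1)

theorem tendsto_fst_rayFilter : Tendsto Prod.fst rayFilter (𝓝 (0 : ℝ)) :=
  tendsto_fst.mono_right nhdsWithin_le_nhds

theorem tendsto_id_nhdsGT_zero : Tendsto (fun m : ℝ => m) (𝓝[>] 0) (𝓝 0) :=
  tendsto_id.mono_right nhdsWithin_le_nhds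

theorem eventually_rayFilter {r : ℝ → ℝ → Prop} :
    (∀ᶠ q in rayFilter, r q.1 q.2) ↔ ∀ᶠ m in 𝓝[>] (0 : ℝ), ∀ ξ ∈ Icc (0 : ℝ) 1, r m ξ :=
  eventually_prod_principal_iff

theorem HasOrder.comp_fst {n : ℕ} {f : ℝ → ℝ} (h : HasOrder (𝓝[>] 0) (fun m => m) n f) :
    HasOrder rayFilter Prod.fst n fun q => f q.1 :=
  IsBigO.comp_tendsto h tendsto_fst

theorem HasOrder.at {n : ℕ} {f : ℝ → ℝ → ℝ} (h : HasOrder rayFilter Prod.fst n fun q => f q.1 q.2)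
    {ξ : ℝ} (hξ : ξ ∈ Icc (0 : ℝ) 1) : HasOrder (𝓝[>] 0) (fun m => m) n fun m => f m ξ := by
  refine IsBigO.comp_tendsto (k := fun m => (m, ξ)) h ?_
  exact tendsto_id.prodMk (tendsto_principal.2 (Eventually.of_forall fun _ => hξ))

/-- A bound on the derivative in the affine parameter bounds the variation along the ray. -/
theorem hasOrder_sub_of_deriv {n : ℕ} {f f' : ℝ → ℝ → ℝ}
    (hd : ∀ᶠ m in 𝓝[>] (0 : ℝ), ∀ ξ ∈ Icc (0 : ℝ) 1,
      HasDerivWithinAt (f m) (f' m ξ) (Icc 0 1) ξ)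
    (h : HasOrder rayFilter Prod.fst n fun q => f' q.1 q.2) :
    HasOrder rayFilter Prod.fst n fun q => f q.1 q.2 - f q.1 0 := by
  obtain ⟨C, hC⟩ := IsBigO.bound h
  refine IsBigO.of_bound C ?_
  refine eventually_rayFilter (r := fun m ξ => ‖f m ξ - f m 0‖ ≤ C * ‖m ^ n‖) |>.2 ?_
  filter_upwards [hd, (eventually_rayFilter (r := fun m ξ => ‖f' m ξ‖ ≤ C * ‖m ^ n‖)).1 hC]
    with m hm hb ξ hξ
  have hz : (0 : ℝ) ∈ Icc (0 : ℝ) 1 := by simp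
  have h1 := (convex_Icc (0 : ℝ) 1).norm_image_sub_le_of_norm_hasDerivWithin_le hm hb hz hξ
  refine h1.trans ?_
  have h2 : ‖ξ - 0‖ ≤ 1 := by
    rw [sub_zero, Real.norm_eq_abs, abs_of_nonneg hξ.1]; exact hξ.2
  have h3 : 0 ≤ C * ‖m ^ n‖ := (norm_nonneg _).trans (hb 0 hz)
  nlinarith

/-! ### Antiderivatives against the kernel `sin (θB - θ)`. -/

open Real

/-- `∫ sin (θB - θ) dθ`. -/
noncomputable def primOne (θB θ : ℝ) : ℝ := sin θB * sin θ + cos θB * cos θ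

/-- `∫ cos θ sin (θB - θ) dθ`. -/
noncomputable def primCos (θB θ : ℝ) : ℝ :=
  sin θB * ((θ + sin θ * cos θ) / 2) + cos θB * (cos θ ^ 2 / 2)

/-- `∫ cos² θ sin (θB - θ) dθ`. -/
noncomputable def primCosSq (θB θ : ℝ) : ℝ :=
  sin θB * (sin θ - sin θ ^ 3 / 3) + cos θB * (cos θ ^ 3 / 3)

/-- The solution of `T'' + T = 1` vanishing at `θA` and `θB`. -/
noncomputable def green (θA θB θ : ℝ) : ℝ :=
  1 - ((sin θB * cos θ - cos θB * sin θ) + (sin θ * cos θA - cos θ * sin θA)) /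
    (sin θB * cos θA - cos θB * sin θA)

/-- `∫ green θ sin (θB - θ) dθ`. -/
noncomputable def primGreen (θA θB θ : ℝ) : ℝ :=
  primOne θB θ - (sin θB ^ 2 * ((θ + sin θ * cos θ) / 2) + sin θB * cos θB * cos θ ^ 2 +
      cos θB ^ 2 * ((θ - sin θ * cos θ) / 2) -
      (cos θA * sin θB + sin θA * cos θB) * (cos θ ^ 2 / 2) -
      cos θA * cos θB * ((θ - sin θ * cos θ) / 2) - sin θA * sin θB * ((θ + sin θ * cos θ) / 2)) /
    (sin θB * cos θA - cos θB * sin θA)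

theorem hasDerivAt_primOne (θB θ : ℝ) :
    HasDerivAt (primOne θB) (sin θB * cos θ - cos θB * sin θ) θ :=
  (((hasDerivAt_sin θ).const_mul (sin θB)).add
    ((hasDerivAt_cos θ).const_mul (cos θB))).congr_deriv (by ring)

theorem hasDerivAt_primCosCos (θ : ℝ) :
    HasDerivAt (fun θ => (θ + sin θ * cos θ) / 2) (cos θ ^ 2) θ :=
  (((hasDerivAt_id θ).add ((hasDerivAt_sin θ).mul (hasDerivAt_cos θ))).div_const 2).congr_deriv
    (by linear_combination (-1 / 2) * sin_sq_add_cos_sq θ)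

theorem hasDerivAt_primSinSin (θ : ℝ) :
    HasDerivAt (fun θ => (θ - sin θ * cos θ) / 2) (sin θ ^ 2) θ :=
  (((hasDerivAt_id θ).sub ((hasDerivAt_sin θ).mul (hasDerivAt_cos θ))).div_const 2).congr_deriv
    (by linear_combination (-1 / 2) * sin_sq_add_cos_sq θ)

theorem hasDerivAt_cos_sq (θ : ℝ) :
    HasDerivAt (fun θ => cos θ ^ 2) (-2 * (sin θ * cos θ)) θ :=
  ((hasDerivAt_cos θ).pow 2).congr_deriv (by norm_num; ring)

theorem hasDerivAt_primCos (θB θ : ℝ) :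
    HasDerivAt (primCos θB) (cos θ * (sin θB * cos θ - cos θB * sin θ)) θ :=
  (((hasDerivAt_primCosCos θ).const_mul (sin θB)).add
    (((hasDerivAt_cos_sq θ).div_const 2).const_mul (cos θB))).congr_deriv (by ring)

theorem hasDerivAt_primCosSq (θB θ : ℝ) :
    HasDerivAt (primCosSq θB) (cos θ ^ 2 * (sin θB * cos θ - cos θB * sin θ)) θ :=
  ((((hasDerivAt_sin θ).sub (((hasDerivAt_sin θ).pow 3).div_const 3)).const_mul (sin θB)).add
    ((((hasDerivAt_cos θ).pow 3).div_const 3).const_mul (cos θB))).congr_deriv (by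
      norm_num
      linear_combination (- sin θB * cos θ) * sin_sq_add_cos_sq θ)

theorem hasDerivAt_primGreen (θA θB θ : ℝ) :
    HasDerivAt (primGreen θA θB) (green θA θB θ * (sin θB * cos θ - cos θB * sin θ)) θ := by
  have hc := hasDerivAt_primCosCos θ
  have hs := hasDerivAt_primSinSin θ
  have hcs := hasDerivAt_cos_sq θ
  exact ((hasDerivAt_primOne θB θ).sub ((((((hc.const_mul (sin θB ^ 2)).add
    (hcs.const_mul (sin θB * cos θB))).add (hs.const_mul (cos θB ^ 2))).sub
    ((hcs.div_const 2).const_mul (cos θA * sin θB + sin θA * cos θB))).sub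
    (hs.const_mul (cos θA * cos θB))).sub (hc.const_mul (sin θA * sin θB)) |>.div_const
    (sin θB * cos θA - cos θB * sin θA))).congr_deriv (by rw [green]; ring)

/-! ### Perturbation expansion of the squared impact parameter. -/

/-- A family of plane rays with polar angle `θ` (of velocity `ω`), inverse radius `u`, scaled
momentum `(P, K)` and impact parameter `b`, from the angle `θA` to the angle `θB`, tending to the
straight line at distance `d` from the origin. -/
structure AngularFamily (g κ κ₃ θA θB d : ℝ) (θ ω u w P K : ℝ → ℝ → ℝ) (b v : ℝ → ℝ) : Prop where
  deriv_θ : ∀ᶠ m in 𝓝[>] (0 : ℝ), ∀ ξ ∈ Icc (0 : ℝ) 1,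
    HasDerivWithinAt (θ m) (ω m ξ) (Icc 0 1) ξ
  deriv_P : ∀ᶠ m in 𝓝[>] (0 : ℝ), ∀ ξ ∈ Icc (0 : ℝ) 1,
    HasDerivWithinAt (P m) (-(m * ω m ξ * w m ξ * sin (θ m ξ))) (Icc 0 1) ξ
  deriv_K : ∀ᶠ m in 𝓝[>] (0 : ℝ), ∀ ξ ∈ Icc (0 : ℝ) 1,
    HasDerivWithinAt (K m) (-(m * ω m ξ * w m ξ * cos (θ m ξ))) (Icc 0 1) ξ
  order_ω : HasOrder rayFilter Prod.fst 0 fun q => ω q.1 q.2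
  order_u : HasOrder rayFilter Prod.fst 0 fun q => u q.1 q.2
  expand_w : HasOrder rayFilter Prod.fst 3 fun q =>
    w q.1 q.2 - (g + 2 * κ * (q.1 * u q.1 q.2) + 3 * κ₃ * (q.1 * u q.1 q.2) ^ 2)
  proj : ∀ᶠ m in 𝓝[>] (0 : ℝ), ∀ ξ ∈ Icc (0 : ℝ) 1,
    P m ξ * cos (θ m ξ) - K m ξ * sin (θ m ξ) = b m ^ 2 * u m ξ
  norm_sq : ∀ᶠ m in 𝓝[>] (0 : ℝ), P m 0 ^ 2 + K m 0 ^ 2 = b m ^ 2 * v m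
  expand_v : HasOrder (𝓝[>] 0) (fun m => m) 4 fun m => v m -
    (1 + 2 * g * (m / d * cos θA) + 2 * κ * (m / d * cos θA) ^ 2 + 2 * κ₃ * (m / d * cos θA) ^ 3)
  expand_b : HasOrder (𝓝[>] 0) (fun m => m) 1 fun m => b m - d
  start_θ : ∀ᶠ m in 𝓝[>] (0 : ℝ), θ m 0 = θA
  end_θ : ∀ᶠ m in 𝓝[>] (0 : ℝ), θ m 1 = θB
  start_u : ∀ᶠ m in 𝓝[>] (0 : ℝ), u m 0 = cos θA / d
  end_u : ∀ᶠ m in 𝓝[>] (0 : ℝ), u m 1 = cos θB / d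

section

variable {g κ κ₃ θA θB d : ℝ} {θ ω u w P K : ℝ → ℝ → ℝ} {b v : ℝ → ℝ}

theorem hasOrder_sin {α : Type*} {l : Filter α} {t : α → ℝ} (f : α → ℝ) :
    HasOrder l t 0 fun x => sin (f x) :=
  hasOrder_of_le 1 (Eventually.of_forall fun _ => abs_sin_le_one _)

theorem hasOrder_cos {α : Type*} {l : Filter α} {t : α → ℝ} (f : α → ℝ) :
    HasOrder l t 0 fun x => cos (f x) :=
  hasOrder_of_le 1 (Eventually.of_forall fun _ => abs_cos_le_one _)

theorem hasOrder_fst : HasOrder rayFilter Prod.fst 1 (fun q : ℝ × ℝ => q.1) := hasOrder_scale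

theorem hasOrder_green {α : Type*} {l : Filter α} {t : α → ℝ} (θA θB : ℝ) (f : α → ℝ) :
    HasOrder l t 0 fun x => green θA θB (f x) := by
  have hs := hasOrder_sin (l := l) (t := t) f
  have hc := hasOrder_cos (l := l) (t := t) f
  refine ((hasOrder_const 1).sub (((((hc.const_mul (sin θB)).sub (hs.const_mul (cos θB)))).add
    ((hs.const_mul (cos θA)).sub (hc.const_mul (sin θA)))).const_mul
    (sin θB * cos θA - cos θB * sin θA)⁻¹)).congr_fun fun x => ?_
  rw [green, div_eq_inv_mul]; ring

theorem AngularFamily.order_w_sub (H : AngularFamily g κ κ₃ θA θB d θ ω u w P K b v) :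
    HasOrder rayFilter Prod.fst 1 fun q => w q.1 q.2 - g := by
  have h1 := H.expand_w.weaken tendsto_fst_rayFilter (n := 1) (by norm_num)
  have h2 : HasOrder rayFilter Prod.fst 1 fun q => q.1 * u q.1 q.2 := hasOrder_fst.mul H.order_u
  have h3 := (h2.mul h2).weaken tendsto_fst_rayFilter (n := 1) (by norm_num)
  exact ((h1.add (h2.const_mul (2 * κ))).add (h3.const_mul (3 * κ₃))).congr_fun fun q => by ring

/-- If `w` were the constant `g`, then `P - m g cos θ` would be conserved; the error `w - g` is of
first order and enters multiplied by `m`. -/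
theorem AngularFamily.order_P (H : AngularFamily g κ κ₃ θA θB d θ ω u w P K b v) :
    HasOrder rayFilter Prod.fst 2 fun q => (P q.1 q.2 - q.1 * g * cos (θ q.1 q.2)) -
      (P q.1 0 - q.1 * g * cos (θ q.1 0)) := by
  refine hasOrder_sub_of_deriv (f := fun m ξ => P m ξ - m * g * cos (θ m ξ))
    (f' := fun m ξ => -1 * (m * (ω m ξ * (w m ξ - g)) * sin (θ m ξ))) ?_ ?_
  · filter_upwards [H.deriv_θ, H.deriv_P] with m h1 h2 ξ hξ
    exact ((h2 ξ hξ).sub ((h1 ξ hξ).cos.const_mul (m * g))).congr_deriv (by ring)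
  · exact ((hasOrder_fst.mul (H.order_ω.mul H.order_w_sub)).mul (hasOrder_sin _)).const_mul _

theorem AngularFamily.order_K (H : AngularFamily g κ κ₃ θA θB d θ ω u w P K b v) :
    HasOrder rayFilter Prod.fst 2 fun q => (K q.1 q.2 + q.1 * g * sin (θ q.1 q.2)) -
      (K q.1 0 + q.1 * g * sin (θ q.1 0)) := by
  refine hasOrder_sub_of_deriv (f := fun m ξ => K m ξ + m * g * sin (θ m ξ))
    (f' := fun m ξ => -1 * (m * (ω m ξ * (w m ξ - g)) * cos (θ m ξ))) ?_ ?_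
  · filter_upwards [H.deriv_θ, H.deriv_K] with m h1 h2 ξ hξ
    exact ((h2 ξ hξ).add ((h1 ξ hξ).sin.const_mul (m * g))).congr_deriv (by ring)
  · exact ((hasOrder_fst.mul (H.order_ω.mul H.order_w_sub)).mul (hasOrder_cos _)).const_mul _

theorem AngularFamily.order_b_inv (hd : d ≠ 0)
    (H : AngularFamily g κ κ₃ θA θB d θ ω u w P K b v) :
    HasOrder (𝓝[>] 0) (fun m => m) 0 (fun m => (b m)⁻¹) ∧ ∀ᶠ m in 𝓝[>] (0 : ℝ), b m ≠ 0 := by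
  refine ⟨H.expand_b.inv hd tendsto_id_nhdsGT_zero, ?_⟩
  have := H.expand_b.tendsto_zero (n := 0) tendsto_id_nhdsGT_zero
  have h2 : Tendsto b (𝓝[>] 0) (𝓝 d) := by simpa using this.add_const d
  exact h2.eventually_ne hd

/-- The inverse radius to first order in `m`. -/
theorem AngularFamily.order_u_sub (hd : d ≠ 0) (hS : sin θB * cos θA - cos θB * sin θA ≠ 0)
    (H : AngularFamily g κ κ₃ θA θB d θ ω u w P K b v) :
    HasOrder rayFilter Prod.fst 2 fun q => u q.1 q.2 -
      (cos (θ q.1 q.2) / d + q.1 * (g / d ^ 2) * green θA θB (θ q.1 q.2)) := by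
  have one : (1 : ℝ) ∈ Icc (0 : ℝ) 1 := by simp
  have zero : (0 : ℝ) ∈ Icc (0 : ℝ) 1 := by simp
  set S := sin θB * cos θA - cos θB * sin θA with hSdef
  obtain ⟨hbi, hb0⟩ := H.order_b_inv hd
  -- `b² u = m g + c₁ cos θ - c₂ sin θ` up to second order
  have hu : HasOrder rayFilter Prod.fst 2 fun q => b q.1 ^ 2 * u q.1 q.2 - (q.1 * g +
      (P q.1 0 - q.1 * g * cos (θ q.1 0)) * cos (θ q.1 q.2) -
      (K q.1 0 + q.1 * g * sin (θ q.1 0)) * sin (θ q.1 q.2)) := by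
    refine ((H.order_P.mul (hasOrder_cos fun q => θ q.1 q.2)).sub
      (H.order_K.mul (hasOrder_sin fun q => θ q.1 q.2))).congr ?_
    refine eventually_rayFilter (r := fun m ξ => (P m ξ - m * g * cos (θ m ξ) -
      (P m 0 - m * g * cos (θ m 0))) * cos (θ m ξ) - (K m ξ + m * g * sin (θ m ξ) -
      (K m 0 + m * g * sin (θ m 0))) * sin (θ m ξ) = b m ^ 2 * u m ξ - (m * g +
      (P m 0 - m * g * cos (θ m 0)) * cos (θ m ξ) -
      (K m 0 + m * g * sin (θ m 0)) * sin (θ m ξ))) |>.2 ?_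
    filter_upwards [H.proj] with m hm ξ hξ
    rw [← hm ξ hξ]
    linear_combination (-m * g) * sin_sq_add_cos_sq (θ m ξ)
  have hend := (HasOrder.at (f := fun m ξ => b m ^ 2 * u m ξ - (m * g +
      (P m 0 - m * g * cos (θ m 0)) * cos (θ m ξ) -
      (K m 0 + m * g * sin (θ m 0)) * sin (θ m ξ))) hu one).comp_fst
  -- elimination of the two constants
  have h1 : HasOrder rayFilter Prod.fst 2 fun q => b q.1 ^ 2 * S * (u q.1 q.2 -
      cos (θ q.1 q.2) / d) - q.1 * g * (S * green θA θB (θ q.1 q.2)) := by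
    refine ((hu.const_mul S).sub (hend.mul
      (((hasOrder_sin fun q : ℝ × ℝ => θ q.1 q.2).const_mul (cos θA)).sub
      ((hasOrder_cos fun q : ℝ × ℝ => θ q.1 q.2).const_mul (sin θA))))).congr ?_
    refine eventually_rayFilter (r := fun m ξ => S * (b m ^ 2 * u m ξ - (m * g +
      (P m 0 - m * g * cos (θ m 0)) * cos (θ m ξ) -
      (K m 0 + m * g * sin (θ m 0)) * sin (θ m ξ))) - (b m ^ 2 * u m 1 - (m * g +
      (P m 0 - m * g * cos (θ m 0)) * cos (θ m 1) -
      (K m 0 + m * g * sin (θ m 0)) * sin (θ m 1))) *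
      (cos θA * sin (θ m ξ) - sin θA * cos (θ m ξ)) =
      b m ^ 2 * S * (u m ξ - cos (θ m ξ) / d) - m * g * (S * green θA θB (θ m ξ))) |>.2 ?_
    filter_upwards [H.proj, H.start_θ, H.end_θ, H.start_u, H.end_u] with m hm e1 e2 e3 e4 ξ hξ
    have hz := hm 0 zero
    rw [e1, e3] at hz
    have hg : S * green θA θB (θ m ξ) = S - ((sin θB * cos (θ m ξ) - cos θB * sin (θ m ξ)) +
        (sin (θ m ξ) * cos θA - cos (θ m ξ) * sin θA)) := by
      rw [green, ← hSdef]; field_simp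
    rw [hg, e1, e2, e4, hSdef]
    have hsc := sin_sq_add_cos_sq θA
    linear_combination (-(sin θB * cos (θ m ξ) - cos θB * sin (θ m ξ))) * hz + (m * g) *
      (sin θB * cos (θ m ξ) - cos θB * sin (θ m ξ)) * hsc
  have h2 : HasOrder rayFilter Prod.fst 2 fun q => (u q.1 q.2 - cos (θ q.1 q.2) / d) -
      q.1 * g * ((b q.1)⁻¹ ^ 2 * green θA θB (θ q.1 q.2)) := by
    refine ((h1.mul (hbi.comp_fst.mul hbi.comp_fst)).const_mul S⁻¹).congr ?_
    refine eventually_rayFilter (r := fun m ξ => S⁻¹ * ((b m ^ 2 * S * (u m ξ -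
      cos (θ m ξ) / d) - m * g * (S * green θA θB (θ m ξ))) * ((b m)⁻¹ * (b m)⁻¹)) =
      (u m ξ - cos (θ m ξ) / d) - m * g * ((b m)⁻¹ ^ 2 * green θA θB (θ m ξ))) |>.2 ?_
    filter_upwards [hb0] with m hm ξ hξ
    field_simp
  -- The first-order term of `u` already carries a factor `m`, so `b⁻²` may be replaced there by its
  -- limit.
  have h3 : HasOrder (𝓝[>] 0) (fun m => m) 1 fun m => (b m)⁻¹ ^ 2 - 1 / d ^ 2 := by
    have hb1 : HasOrder (𝓝[>] 0) (fun m => m) 0 fun m => b m + d := by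
      refine ((H.expand_b.weaken tendsto_id_nhdsGT_zero (n := 0) (by norm_num)).add
        (hasOrder_const (2 * d))).congr_fun fun m => by ring
    refine (((H.expand_b.mul hb1).mul (hbi.mul hbi)).const_mul (-1 / d ^ 2)).congr ?_
    filter_upwards [hb0] with m hm
    field_simp
    ring
  refine (h2.add (((hasOrder_fst.const_mul g).mul h3.comp_fst).mul
    (hasOrder_green θA θB fun q : ℝ × ℝ => θ q.1 q.2))).congr_fun fun q => ?_
  ring

/-- First order of the transverse deflection along the straight line. -/
noncomputable def bendOne (g θA θB : ℝ) : ℝ :=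
  g * (primOne θB θB - primOne θB θA) / (sin θB * cos θA - cos θB * sin θA)

/-- Second order of the transverse deflection along the straight line. -/
noncomputable def bendTwo (κ θA θB : ℝ) : ℝ :=
  2 * κ * (primCos θB θB - primCos θB θA) / (sin θB * cos θA - cos θB * sin θA)

/-- Third order of the transverse deflection along the straight line. -/
noncomputable def bendThree (g κ κ₃ θA θB : ℝ) : ℝ :=
  (2 * κ * g * (primGreen θA θB θB - primGreen θA θB θA) +
    3 * κ₃ * (primCosSq θB θB - primCosSq θB θA)) / (sin θB * cos θA - cos θB * sin θA)

/-- In `w` the linear term in `m u` needs `u` modulo `m²`, while the quadratic term needs it only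
modulo `m`. -/
theorem AngularFamily.order_w_sub_approx (hd : d ≠ 0)
    (hS : sin θB * cos θA - cos θB * sin θA ≠ 0)
    (H : AngularFamily g κ κ₃ θA θB d θ ω u w P K b v) :
    HasOrder rayFilter Prod.fst 3 fun q => w q.1 q.2 - (g + q.1 * (2 * κ / d) * cos (θ q.1 q.2) +
      q.1 ^ 2 * (2 * κ * g / d ^ 2 * green θA θB (θ q.1 q.2) +
        3 * κ₃ / d ^ 2 * cos (θ q.1 q.2) ^ 2)) := by
  have h2 := H.order_u_sub hd hS
  have hc := hasOrder_cos (l := rayFilter) (t := Prod.fst) fun q : ℝ × ℝ => θ q.1 q.2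
  have h1 : HasOrder rayFilter Prod.fst 1 fun q => u q.1 q.2 - 1 / d * cos (θ q.1 q.2) := by
    refine ((h2.weaken tendsto_fst_rayFilter (n := 1) (by norm_num)).add
      ((hasOrder_fst.mul (hasOrder_green θA θB fun q : ℝ × ℝ => θ q.1 q.2)).const_mul
        (g / d ^ 2))).congr_fun fun q => ?_
    ring
  have h3 := h1.mul (H.order_u.add (hc.const_mul (1 / d)))
  refine ((H.expand_w.add ((hasOrder_fst.mul h2).const_mul (2 * κ))).add
    (((hasOrder_fst.mul hasOrder_fst).mul h3).const_mul (3 * κ₃))).congr_fun fun q => ?_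
  field_simp
  ring

/-- The momentum transverse to the radius at the far end has derivative `m ω w sin (θB - θ)`. With
the approximation of `w` inserted, this is the derivative of an explicit function of `θ`, up to
`O(m⁴)`. -/
theorem AngularFamily.order_transfer (hd : d ≠ 0)
    (hS : sin θB * cos θA - cos θB * sin θA ≠ 0)
    (H : AngularFamily g κ κ₃ θA θB d θ ω u w P K b v) :
    HasOrder (𝓝[>] 0) (fun m => m) 4 fun m =>
      b m ^ 2 * (cos θB / d) - (P m 0 * cos θB - K m 0 * sin θB) -
      (sin θB * cos θA - cos θB * sin θA) * d * (bendOne g θA θB * (m / d) +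
        bendTwo κ θA θB * (m / d) ^ 2 + bendThree g κ κ₃ θA θB * (m / d) ^ 3) := by
  have one : (1 : ℝ) ∈ Icc (0 : ℝ) 1 := by simp
  -- Antiderivative in the angle of the approximate `w` times `sin (θB - θ)`.
  let G : ℝ → ℝ → ℝ := fun m t => g * primOne θB t + m * (2 * κ / d) * primCos θB t +
    m ^ 2 * (2 * κ * g / d ^ 2 * primGreen θA θB t + 3 * κ₃ / d ^ 2 * primCosSq θB t)
  have hG : ∀ m t, HasDerivAt (G m) ((g + m * (2 * κ / d) * cos t +
      m ^ 2 * (2 * κ * g / d ^ 2 * green θA θB t + 3 * κ₃ / d ^ 2 * cos t ^ 2)) *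
      (sin θB * cos t - cos θB * sin t)) t := fun m t =>
    ((((hasDerivAt_primOne θB t).const_mul g).add
      ((hasDerivAt_primCos θB t).const_mul (m * (2 * κ / d)))).add
      ((((hasDerivAt_primGreen θA θB t).const_mul (2 * κ * g / d ^ 2)).add
      ((hasDerivAt_primCosSq θB t).const_mul (3 * κ₃ / d ^ 2))).const_mul (m ^ 2))).congr_deriv
      (by ring)
  have h1 := hasOrder_sub_of_deriv (n := 4)
    (f := fun m ξ => P m ξ * cos θB - K m ξ * sin θB - m * G m (θ m ξ))
    (f' := fun m ξ => m * (ω m ξ * (w m ξ - (g + m * (2 * κ / d) * cos (θ m ξ) +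
      m ^ 2 * (2 * κ * g / d ^ 2 * green θA θB (θ m ξ) + 3 * κ₃ / d ^ 2 * cos (θ m ξ) ^ 2)))) *
      (sin θB * cos (θ m ξ) - cos θB * sin (θ m ξ))) ?_ ?_
  · have h2 := HasOrder.at (f := fun m ξ => (P m ξ * cos θB - K m ξ * sin θB - m * G m (θ m ξ)) -
      (P m 0 * cos θB - K m 0 * sin θB - m * G m (θ m 0))) h1 one
    refine h2.congr ?_
    filter_upwards [H.proj, H.start_θ, H.end_θ, H.end_u] with m hm e1 e2 e3
    have hz := hm 1 one
    rw [e2, e3] at hz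
    rw [← hz, e1, e2]
    simp only [G, bendOne, bendTwo, bendThree]
    field_simp
    ring
  · filter_upwards [H.deriv_θ, H.deriv_P, H.deriv_K] with m h1 h2 h3 ξ hξ
    exact ((((h2 ξ hξ).mul_const (cos θB)).sub ((h3 ξ hξ).mul_const (sin θB))).sub
      (((hG m (θ m ξ)).comp_hasDerivWithinAt ξ (h1 ξ hξ)).const_mul m)).congr_deriv (by ring)
  · exact (hasOrder_fst.mul (H.order_ω.mul (H.order_w_sub_approx hd hS))).mul
      (((hasOrder_cos _).const_mul _).sub ((hasOrder_sin _).const_mul _))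

theorem hasOrder_of_continuous {f : ℝ → ℝ} (hf : Continuous f) :
    HasOrder (𝓝[>] 0) (fun m => m) 0 f := by
  have := ((hf.tendsto 0).mono_left (nhdsWithin_le_nhds (s := Ioi 0))).isBigO_one ℝ
  simpa [HasOrder] using this

theorem hasOrder_mul_pow {f : ℝ → ℝ} (hf : Continuous f) (n : ℕ) :
    HasOrder (𝓝[>] 0) (fun m => m) n fun m => m ^ n * f m := by
  have h1 : HasOrder (𝓝[>] 0) (fun m : ℝ => m) n fun m => m ^ n := isBigO_refl _ _
  simpa using h1.mul (hasOrder_of_continuous hf)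

/-- At the near end the transverse component of `(P, K)` is exactly `b² cos θA / d`. The transfer
relation then gives the radial component, and the Pythagorean relation with `P² + K² = b² v` yields
an equation in `b` alone. -/
theorem AngularFamily.order_quadratic (hd : d ≠ 0)
    (hS : sin θB * cos θA - cos θB * sin θA ≠ 0)
    (H : AngularFamily g κ κ₃ θA θB d θ ω u w P K b v) :
    HasOrder (𝓝[>] 0) (fun m => m) 4 fun m => ((b m / d) ^ 2) ^ 2 + 2 * sin θA *
      (bendOne g θA θB * (m / d) + bendTwo κ θA θB * (m / d) ^ 2 +
        bendThree g κ κ₃ θA θB * (m / d) ^ 3) * (b m / d) ^ 2 +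
      (bendOne g θA θB * (m / d) + bendTwo κ θA θB * (m / d) ^ 2 +
        bendThree g κ κ₃ θA θB * (m / d) ^ 3) ^ 2 - (b m / d) ^ 2 * v m := by
  have zero : (0 : ℝ) ∈ Icc (0 : ℝ) 1 := by simp
  have ht := H.order_transfer hd hS
  set S := sin θB * cos θA - cos θB * sin θA with hSdef
  set k : ℝ → ℝ := fun m => bendOne g θA θB * (m / d) + bendTwo κ θA θB * (m / d) ^ 2 +
        bendThree g κ κ₃ θA θB * (m / d) ^ 3 with hk
  have hkc : Continuous k := by rw [hk]; fun_prop
  have h1 : HasOrder (𝓝[>] 0) (fun m => m) 4 fun m =>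
      (P m 0 * sin θA + K m 0 * cos θA) / d - ((b m / d) ^ 2 * sin θA + k m) := by
    refine (ht.const_mul (S * d)⁻¹).congr ?_
    filter_upwards [H.proj, H.start_θ, H.start_u] with m hm e1 e2
    have hz := hm 0 zero
    rw [e1, e2] at hz
    have key : b m ^ 2 * (cos θB / d) - (P m 0 * cos θB - K m 0 * sin θB) - S * d * k m =
        S * d * ((P m 0 * sin θA + K m 0 * cos θA) / d - ((b m / d) ^ 2 * sin θA + k m)) := by
      have hsc := sin_sq_add_cos_sq θA
      have e3 : S * d * ((P m 0 * sin θA + K m 0 * cos θA) / d - ((b m / d) ^ 2 * sin θA + k m))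
        = S * (P m 0 * sin θA + K m 0 * cos θA) - S * (b m ^ 2 / d) * sin θA - S * d * k m := by
        field_simp
        ring
      have e4 : b m ^ 2 * (cos θB / d) = b m ^ 2 / d * cos θB := by ring
      have e5 : b m ^ 2 * (cos θA / d) = b m ^ 2 / d * cos θA := by ring
      rw [e5] at hz
      rw [e3, e4, hSdef]
      linear_combination (-(cos θA * cos θB + sin θA * sin θB)) * hz +
        (-(b m ^ 2 / d * cos θB) + P m 0 * cos θB - K m 0 * sin θB) * hsc
    change (S * d)⁻¹ * (b m ^ 2 * (cos θB / d) - (P m 0 * cos θB - K m 0 * sin θB) -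
      S * d * k m) = _
    rw [key, inv_mul_cancel_left₀ (mul_ne_zero hS hd)]
  have hb : HasOrder (𝓝[>] 0) (fun m => m) 0 fun m => b m / d :=
    (((H.expand_b.weaken tendsto_id_nhdsGT_zero (n := 0) (by norm_num)).add
      (hasOrder_const d)).const_mul d⁻¹).congr_fun fun m => by field_simp; ring
  have h2 : HasOrder (𝓝[>] 0) (fun m => m) 0 fun m => (b m / d) ^ 2 * sin θA + k m :=
    (((hb.mul hb).const_mul (sin θA)).add (hasOrder_of_continuous hkc)).congr_fun
      fun m => by ring
  -- Sum of the radial component and its approximation: the squares of two quantities differing by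
  -- `O(m⁴)` differ by `O(m⁴)` once this sum is bounded.
  have h3 := (h1.weaken tendsto_id_nhdsGT_zero (n := 0) (by norm_num)).add (h2.const_mul 2)
  refine ((h1.mul h3).const_mul (-1)).congr ?_
  filter_upwards [H.proj, H.start_θ, H.start_u, H.norm_sq] with m hm e1 e2 e3
  have hz := hm 0 zero
  rw [e1, e2] at hz
  have hsc := sin_sq_add_cos_sq θA
  have e4 : ((P m 0 * sin θA + K m 0 * cos θA) / d) ^ 2 =
      (b m / d) ^ 2 * v m - ((b m / d) ^ 2) ^ 2 * cos θA ^ 2 := by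
    have : (P m 0 * sin θA + K m 0 * cos θA) ^ 2 = b m ^ 2 * v m -
        (b m ^ 2 * (cos θA / d)) ^ 2 := by
      rw [← hz, ← e3]
      linear_combination (P m 0 ^ 2 + K m 0 ^ 2) * hsc
    rw [div_pow, this]
    field_simp
  change -1 * (((P m 0 * sin θA + K m 0 * cos θA) / d - ((b m / d) ^ 2 * sin θA + k m)) *
    (((P m 0 * sin θA + K m 0 * cos θA) / d - ((b m / d) ^ 2 * sin θA + k m)) +
      2 * ((b m / d) ^ 2 * sin θA + k m))) = ((b m / d) ^ 2) ^ 2 + 2 * sin θA * k m * (b m / d) ^ 2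
      + k m ^ 2 - (b m / d) ^ 2 * v m
  linear_combination -e4 + ((b m / d) ^ 2) ^ 2 * hsc

/-- The square of the reduced impact parameter to third order in `m`. -/
theorem AngularFamily.expand_sq (hd : d ≠ 0) (hS : sin θB * cos θA - cos θB * sin θA ≠ 0)
    (H : AngularFamily g κ κ₃ θA θB d θ ω u w P K b v) {k₁ k₂ k₃ β₁ : ℝ}
    (hk₁ : bendOne g θA θB = k₁) (hk₂ : bendTwo κ θA θB = k₂)
    (hk₃ : bendThree g κ κ₃ θA θB = k₃) (hβ₁ : 2 * (g * cos θA - sin θA * k₁) = β₁) :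
    HasOrder (𝓝[>] 0) (fun m => m) 4 fun m => (b m / d) ^ 2 - (1 + β₁ * (m / d) +
      (2 * κ * cos θA ^ 2 - 2 * sin θA * k₂ - k₁ ^ 2) * (m / d) ^ 2 +
      (2 * κ₃ * cos θA ^ 3 - 2 * sin θA * k₃ - 2 * k₁ * k₂ + k₁ ^ 2 * β₁) * (m / d) ^ 3) := by
  have ht := tendsto_id_nhdsGT_zero
  have hq := H.order_quadratic hd hS
  rw [hk₁, hk₂, hk₃] at hq
  set z : ℝ → ℝ := fun m => (b m / d) ^ 2 with hz
  have hv := H.expand_v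
  obtain ⟨hbi, hb0⟩ := H.order_b_inv hd
  have hzi : HasOrder (𝓝[>] 0) (fun m => m) 0 fun m => (z m)⁻¹ :=
    ((hbi.mul hbi).const_mul (d ^ 2)).congr_fun fun m => by
      simp only [hz, div_pow, inv_div]; rw [div_eq_mul_inv]; ring
  have hz0 : ∀ᶠ m in 𝓝[>] (0 : ℝ), z m ≠ 0 := by
    filter_upwards [hb0] with m hm
    exact pow_ne_zero 2 (div_ne_zero hm hd)
  set k : ℝ → ℝ := fun m => k₁ * (m / d) + k₂ * (m / d) ^ 2 + k₃ * (m / d) ^ 3 with hk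
  have hk2 : HasOrder (𝓝[>] 0) (fun m => m) 2 fun m => k m ^ 2 :=
    (hasOrder_mul_pow (f := fun m => (k₁ / d + k₂ / d * (m / d) + k₃ / d * (m / d) ^ 2) ^ 2)
      (by fun_prop) 2).congr_fun fun m => by simp only [hk]; ring
  -- The quadratic equation divided by `z`. As `k²` is already of second order, `z⁻¹` is needed only
  -- to first order, which a preliminary expansion `h2` of `z` provides.
  have h1 : HasOrder (𝓝[>] 0) (fun m => m) 4 fun m =>
      z m + 2 * sin θA * k m - v m + k m ^ 2 * (z m)⁻¹ := by
    refine (hq.mul hzi).congr ?_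
    filter_upwards [hz0] with m hm
    change (z m ^ 2 + 2 * sin θA * k m * z m + k m ^ 2 - z m * v m) * (z m)⁻¹ = _
    field_simp
    ring
  have h2 : HasOrder (𝓝[>] 0) (fun m => m) 2 fun m => z m - (1 + β₁ * (m / d)) := by
    refine ((((h1.weaken ht (n := 2) (by norm_num)).sub (hk2.mul hzi)).add
      (hv.weaken ht (n := 2) (by norm_num))).add (hasOrder_mul_pow
      (f := fun m => 2 * κ * cos θA ^ 2 / d ^ 2 + 2 * κ₃ * cos θA ^ 3 / d ^ 3 * m -
        2 * sin θA * (k₂ / d ^ 2 + k₃ / d ^ 3 * m)) (by fun_prop) 2)).congr_fun fun m => ?_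
    simp only [hk, ← hβ₁]
    ring
  have h3 : HasOrder (𝓝[>] 0) (fun m => m) 2 fun m => (z m)⁻¹ - (1 - β₁ * (m / d)) := by
    have h4 : HasOrder (𝓝[>] 0) (fun m => m) 1 fun m => z m - 1 :=
      ((h2.weaken ht (n := 1) (by norm_num)).add ((hasOrder_scale).const_mul (β₁ / d))).congr_fun
        fun m => by ring
    refine (hzi.mul (((hasOrder_scale.mul h4).const_mul (β₁ / d)).sub h2)).congr ?_
    filter_upwards [hz0] with m hm
    field_simp
    ring
  -- The explicit function removes the terms of degree at least four in `k² (1 - β₁ m / d)`.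
  refine (((h1.add hv).sub (hk2.mul h3)).add (hasOrder_mul_pow (f := fun m =>
    (β₁ * (2 * k₁ * k₂) - (k₂ ^ 2 + 2 * k₁ * k₃)) / d ^ 4 +
    (β₁ * (k₂ ^ 2 + 2 * k₁ * k₃) - 2 * k₂ * k₃) / d ^ 5 * m +
    (β₁ * (2 * k₂ * k₃) - k₃ ^ 2) / d ^ 6 * m ^ 2 + β₁ * k₃ ^ 2 / d ^ 7 * m ^ 3)
    (by fun_prop) 4)).congr_fun fun m => ?_
  simp only [hk, ← hβ₁]
  ring

end

/-! ### Polar coordinates of a plane ray. -/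

/-- The area law: `r²` times the angular velocity is the speed factor times the conserved moment. -/
theorem IsPlaneRay.hasDerivWithinAt_arctan {U σ a h p k : ℝ → ℝ} {b : ℝ}
    (H : IsPlaneRay U σ a h p k b) {ξ : ℝ} (hξ : ξ ∈ Icc (0 : ℝ) 1) (hh : 0 < h ξ) :
    HasDerivWithinAt (fun t => arctan (a t / h t))
      (σ ξ * b * (√(a ξ ^ 2 + h ξ ^ 2))⁻¹ ^ 2) (Icc 0 1) ξ := by
  refine (((H.deriv_a ξ hξ).div (H.deriv_h ξ hξ) hh.ne').arctan).congr_deriv ?_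
  have hp : 0 < a ξ ^ 2 + h ξ ^ 2 := by positivity
  rw [← H.moment ξ hξ, inv_pow, sq_sqrt hp.le]
  simp only [Pi.div_apply]
  have h1 : 1 + (a ξ / h ξ) ^ 2 = (a ξ ^ 2 + h ξ ^ 2) / h ξ ^ 2 := by field_simp; ring
  rw [h1]
  field_simp

theorem sin_arctan_div {a h : ℝ} (hh : 0 < h) :
    sin (arctan (a / h)) = a * (√(a ^ 2 + h ^ 2))⁻¹ := by
  have h1 : 1 + (a / h) ^ 2 = (a ^ 2 + h ^ 2) / h ^ 2 := by field_simp; ring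
  rw [sin_arctan, h1, sqrt_div' _ (by positivity), sqrt_sq hh.le]
  field_simp

theorem cos_arctan_div {a h : ℝ} (hh : 0 < h) :
    cos (arctan (a / h)) = h * (√(a ^ 2 + h ^ 2))⁻¹ := by
  have h1 : 1 + (a / h) ^ 2 = (a ^ 2 + h ^ 2) / h ^ 2 := by field_simp; ring
  rw [cos_arctan, h1, sqrt_div' _ (by positivity), sqrt_sq hh.le]
  field_simp

theorem HasOrder.pow_scale {α : Type*} {l : Filter α} {t f : α → ℝ} (h : HasOrder l t 1 f) (n : ℕ) :
    HasOrder l t n fun x => f x ^ n := by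
  have h1 : f =O[l] t := by simpa only [HasOrder, pow_one] using h
  exact h1.pow n

theorem deriv_comp_div {V : ℝ → ℝ} {m r : ℝ} (hr : r ≠ 0) (hV : DifferentiableAt ℝ V (m / r)) :
    deriv (fun r => V (m / r)) r = -(deriv V (m / r) * m / r ^ 2) := by
  have h1 : HasDerivAt (fun r => m / r) (-m / r ^ 2) r :=
    ((hasDerivAt_inv hr).const_mul m).congr_deriv (by ring)
  have h2 : HasDerivAt (fun r => V (m / r)) _ r := hV.hasDerivAt.comp r h1
  rw [h2.deriv]
  ring

/-- The chart `arctan (a / h)` requires `h > 0` along the whole ray. The transverse momentum starts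
at `O(m)` and is driven by a force of order `m`, so it stays `O(m)`; integrating again, `h` stays
within `O(m)` of `d > 0`. -/
theorem angularFamily_of_isPlaneRay {V : ℝ → ℝ} {g κ κ₃ d aA aB rh : ℝ} (hd : 0 < d)
    (hrh : 0 < rh) (hV : ∀ᶠ x in 𝓝 (0 : ℝ), DifferentiableAt ℝ V x)
    (hV0 : (fun x => V x - (1 + 2 * g * x + 2 * κ * x ^ 2 + 2 * κ₃ * x ^ 3)) =O[𝓝 0]
      fun x => x ^ 4)
    (hV1 : (fun x => deriv V x / 2 - (g + 2 * κ * x + 3 * κ₃ * x ^ 2)) =O[𝓝 0] fun x => x ^ 3)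
    {σ a h p k : ℝ → ℝ → ℝ} {b : ℝ → ℝ}
    (hray : ∀ᶠ m in 𝓝[>] (0 : ℝ),
      IsPlaneRay (fun r => V (m / r)) (σ m) (a m) (h m) (p m) (k m) (b m))
    (hfar : ∀ᶠ m in 𝓝[>] (0 : ℝ), ∀ ξ ∈ Icc (0 : ℝ) 1, rh < √(a m ξ ^ 2 + h m ξ ^ 2))
    (hσ : HasOrder rayFilter Prod.fst 0 fun q => σ q.1 q.2)
    (hb : HasOrder (𝓝[>] 0) (fun m => m) 1 fun m => b m - d)
    (hk : HasOrder (𝓝[>] 0) (fun m => m) 1 fun m => k m 0)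
    (ha0 : ∀ᶠ m in 𝓝[>] (0 : ℝ), a m 0 = aA) (ha1 : ∀ᶠ m in 𝓝[>] (0 : ℝ), a m 1 = aB)
    (hh0 : ∀ᶠ m in 𝓝[>] (0 : ℝ), h m 0 = d) (hh1 : ∀ᶠ m in 𝓝[>] (0 : ℝ), h m 1 = d) :
    AngularFamily g κ κ₃ (arctan (aA / d)) (arctan (aB / d)) d
      (fun m ξ => arctan (a m ξ / h m ξ)) (fun m ξ => σ m ξ * b m * (√(a m ξ ^ 2 + h m ξ ^ 2))⁻¹ ^ 2)
      (fun m ξ => (√(a m ξ ^ 2 + h m ξ ^ 2))⁻¹)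
      (fun m ξ => deriv V (m * (√(a m ξ ^ 2 + h m ξ ^ 2))⁻¹) / 2)
      (fun m ξ => b m * p m ξ) (fun m ξ => b m * k m ξ) b
      (fun m => V (m / d * cos (arctan (aA / d)))) := by
  have zero : (0 : ℝ) ∈ Icc (0 : ℝ) 1 := by simp
  have one : (1 : ℝ) ∈ Icc (0 : ℝ) 1 := by simp
  have ht := tendsto_fst_rayFilter
  set u : ℝ → ℝ → ℝ := fun m ξ => (√(a m ξ ^ 2 + h m ξ ^ 2))⁻¹ with hu
  have ou : HasOrder rayFilter Prod.fst 0 fun q => u q.1 q.2 := by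
    refine hasOrder_of_le rh⁻¹ (eventually_rayFilter (r := fun m ξ => |u m ξ| ≤ rh⁻¹) |>.2 ?_)
    filter_upwards [hfar] with m hm ξ hξ
    have h1 := hm ξ hξ
    rw [abs_of_nonneg (inv_nonneg.2 (sqrt_nonneg _))]
    exact inv_anti₀ hrh h1.le
  have omu : HasOrder rayFilter Prod.fst 1 fun q => q.1 * u q.1 q.2 := hasOrder_fst.mul ou
  have tmu : Tendsto (fun q : ℝ × ℝ => q.1 * u q.1 q.2) rayFilter (𝓝 0) :=
    omu.tendsto_zero (n := 0) ht
  have ow : HasOrder rayFilter Prod.fst 3 fun q : ℝ × ℝ => deriv V (q.1 * u q.1 q.2) / 2 -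
      (g + 2 * κ * (q.1 * u q.1 q.2) + 3 * κ₃ * (q.1 * u q.1 q.2) ^ 2) := by
    exact IsBigO.trans (hV1.comp_tendsto tmu) (omu.pow_scale 3)
  have oV : HasOrder rayFilter Prod.fst 0 fun q : ℝ × ℝ => V (q.1 * u q.1 q.2) := by
    have h1 : HasOrder rayFilter Prod.fst 4 fun q : ℝ × ℝ => V (q.1 * u q.1 q.2) -
      (1 + 2 * g * (q.1 * u q.1 q.2) + 2 * κ * (q.1 * u q.1 q.2) ^ 2 +
        2 * κ₃ * (q.1 * u q.1 q.2) ^ 3) := by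
      exact IsBigO.trans (hV0.comp_tendsto tmu) (omu.pow_scale 4)
    have o0 := omu.weaken ht (n := 0) (by norm_num)
    refine ((h1.weaken ht (n := 0) (by norm_num)).add ((((hasOrder_const 1).add
      (o0.const_mul (2 * g))).add ((o0.mul o0).const_mul (2 * κ))).add
      (((o0.mul o0).mul o0).const_mul (2 * κ₃)))).congr_fun fun q => by ring
  have ow0 : HasOrder rayFilter Prod.fst 0 fun q : ℝ × ℝ => deriv V (q.1 * u q.1 q.2) / 2 := by
    have o0 := omu.weaken ht (n := 0) (by norm_num)
    refine ((ow.weaken ht (n := 0) (by norm_num)).add (((hasOrder_const g).add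
      (o0.const_mul (2 * κ))).add ((o0.mul o0).const_mul (3 * κ₃)))).congr_fun fun q => by ring
  have hpos : ∀ᶠ m in 𝓝[>] (0 : ℝ), ∀ ξ ∈ Icc (0 : ℝ) 1, 0 < √(a m ξ ^ 2 + h m ξ ^ 2) := by
    filter_upwards [hfar] with m hm ξ hξ using hrh.trans (hm ξ hξ)
  have hdiff : ∀ᶠ m in 𝓝[>] (0 : ℝ), ∀ ξ ∈ Icc (0 : ℝ) 1, DifferentiableAt ℝ V (m * u m ξ) :=
    eventually_rayFilter (r := fun m ξ => DifferentiableAt ℝ V (m * u m ξ)) |>.1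
      (tmu.eventually hV)
  have hforce : ∀ᶠ m in 𝓝[>] (0 : ℝ), ∀ ξ ∈ Icc (0 : ℝ) 1,
      deriv (fun r => V (m / r)) √(a m ξ ^ 2 + h m ξ ^ 2) / (2 * √(a m ξ ^ 2 + h m ξ ^ 2)) =
        -(m * (deriv V (m * u m ξ) / 2) * u m ξ ^ 3) := by
    filter_upwards [hpos, hdiff] with m h1 h2 ξ hξ
    rw [deriv_comp_div (h1 ξ hξ).ne' (by simpa [hu, div_eq_mul_inv] using h2 ξ hξ)]
    simp only [hu, div_eq_mul_inv]
    field_simp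
  have ok : HasOrder rayFilter Prod.fst 0 fun q => k q.1 q.2 := by
    obtain ⟨C, hC⟩ := oV.exists_bound
    refine hasOrder_of_le (C + 1) ?_
    refine eventually_rayFilter (r := fun m ξ => |k m ξ| ≤ C + 1) |>.2 ?_
    filter_upwards [hray, eventually_rayFilter (r := fun m ξ => |V (m * u m ξ)| ≤ C) |>.1 hC]
      with m h1 h2 ξ hξ
    have h3 := h1.norm_sq ξ hξ
    have h4 := (le_abs_self _).trans (h2 ξ hξ)
    simp only [div_eq_mul_inv] at h3
    simp only [hu] at h4
    rw [← h3] at h4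
    rw [abs_le]
    constructor <;> nlinarith [sq_nonneg (p m ξ), sq_nonneg (k m ξ - 1), sq_nonneg (k m ξ + 1)]
  have hunit : ∀ m ξ, |h m ξ * u m ξ| ≤ 1 := by
    intro m ξ
    rw [← sq_le_one_iff_abs_le_one, mul_pow, inv_pow, sq_sqrt (by positivity)]
    exact div_le_one_of_le₀ (by nlinarith [sq_nonneg (a m ξ)]) (by positivity)
  have ohu : HasOrder rayFilter Prod.fst 0 fun q : ℝ × ℝ => h q.1 q.2 * u q.1 q.2 :=
    hasOrder_of_le 1 (Eventually.of_forall fun q => hunit q.1 q.2)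
  have ok1 : HasOrder rayFilter Prod.fst 1 fun q => k q.1 q.2 := by
    have h1 := hasOrder_sub_of_deriv (n := 1) (f := k) (f' := fun m ξ => -1 * (m *
      ((σ m ξ * (deriv V (m * u m ξ) / 2)) * ((u m ξ * u m ξ) * (h m ξ * u m ξ))))) ?_ ?_
    · exact (h1.add hk.comp_fst).congr_fun fun q => by ring
    · filter_upwards [hray, hforce] with m h1 h2 ξ hξ
      refine (h1.deriv_k ξ hξ).congr_deriv ?_
      rw [h2 ξ hξ]; ring
    · exact (hasOrder_fst.mul ((hσ.mul ow0).mul ((ou.mul ou).mul ohu))).const_mul (-1)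
  have oh : HasOrder rayFilter Prod.fst 1 fun q => h q.1 q.2 - d := by
    have h1 := hasOrder_sub_of_deriv (n := 1) (f := h) (f' := fun m ξ => σ m ξ * k m ξ) ?_ ?_
    · refine h1.congr ?_
      refine eventually_rayFilter (r := fun m ξ => h m ξ - h m 0 = h m ξ - d) |>.2 ?_
      filter_upwards [hh0] with m hm ξ _
      rw [hm]
    · filter_upwards [hray] with m h1 ξ hξ using h1.deriv_h ξ hξ
    · exact hσ.mul ok1
  have hhpos : ∀ᶠ m in 𝓝[>] (0 : ℝ), ∀ ξ ∈ Icc (0 : ℝ) 1, 0 < h m ξ := by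
    refine eventually_rayFilter (r := fun m ξ => 0 < h m ξ) |>.1 ?_
    have := oh.tendsto_zero (n := 0) ht
    have h2 : Tendsto (fun q : ℝ × ℝ => h q.1 q.2) rayFilter (𝓝 d) := by
      simpa using this.add_const d
    exact h2.eventually_const_lt hd
  have ob : HasOrder (𝓝[>] 0) (fun m => m) 0 b :=
    ((hb.weaken tendsto_id_nhdsGT_zero (n := 0) (by norm_num)).add (hasOrder_const d)).congr_fun
      fun m => by ring
  have hcosA : cos (arctan (aA / d)) / d = (√(aA ^ 2 + d ^ 2))⁻¹ := by
    rw [cos_arctan_div hd]; field_simp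
  have hcosB : cos (arctan (aB / d)) / d = (√(aB ^ 2 + d ^ 2))⁻¹ := by
    rw [cos_arctan_div hd]; field_simp
  constructor
  · filter_upwards [hray, hhpos] with m h1 h2 ξ hξ
    exact h1.hasDerivWithinAt_arctan hξ (h2 ξ hξ)
  · filter_upwards [hray, hhpos, hforce] with m h1 h2 h3 ξ hξ
    refine ((h1.deriv_p ξ hξ).const_mul (b m)).congr_deriv ?_
    rw [h3 ξ hξ, sin_arctan_div (h2 ξ hξ)]
    ring
  · filter_upwards [hray, hhpos, hforce] with m h1 h2 h3 ξ hξ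
    refine ((h1.deriv_k ξ hξ).const_mul (b m)).congr_deriv ?_
    rw [h3 ξ hξ, cos_arctan_div (h2 ξ hξ)]
    ring
  · exact ((hσ.mul ob.comp_fst).mul (ou.mul ou)).congr_fun fun q => by ring
  · exact ou
  · exact ow
  · filter_upwards [hray, hhpos] with m h1 h2 ξ hξ
    rw [sin_arctan_div (h2 ξ hξ), cos_arctan_div (h2 ξ hξ), ← h1.moment ξ hξ]
    ring
  · filter_upwards [hray, ha0, hh0] with m h1 e1 e2
    have h2 := h1.norm_sq 0 zero
    rw [e1, e2] at h2
    have e3 : m / d * cos (arctan (aA / d)) = m / √(aA ^ 2 + d ^ 2) := by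
      rw [div_mul_eq_mul_div, mul_div_assoc, hcosA, div_eq_mul_inv]
    rw [e3, ← h2]; ring
  · have t1 : Tendsto (fun m : ℝ => m / d * cos (arctan (aA / d))) (𝓝[>] 0) (𝓝 0) := by
      have : Continuous fun m : ℝ => m / d * cos (arctan (aA / d)) := by fun_prop
      simpa using (this.tendsto 0).mono_left nhdsWithin_le_nhds
    refine IsBigO.trans (hV0.comp_tendsto t1) ?_
    have : (fun m : ℝ => m / d * cos (arctan (aA / d))) =O[𝓝[>] 0] fun m => m :=
      ((isBigO_refl (fun m : ℝ => m) _).const_mul_left (cos (arctan (aA / d)) / d)).congr_left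
        fun m => by ring
    exact this.pow 4
  · exact hb
  · filter_upwards [ha0, hh0] with m e1 e2
    rw [e1, e2]
  · filter_upwards [ha1, hh1] with m e1 e2
    rw [e1, e2]
  · filter_upwards [ha0, hh0] with m e1 e2
    rw [hcosA, ← e1, ← e2]
  · filter_upwards [ha1, hh1] with m e1 e2
    rw [hcosB, ← e1, ← e2]

/-! ### Trigonometric form of the coefficients. -/

theorem bendOne_eq (g : ℝ) {θA θB : ℝ} (hS : sin (θB - θA) ≠ 0) :
    bendOne g θA θB = g * sin (θB - θA) / (1 + cos (θB - θA)) := by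
  have hC : 1 + cos (θB - θA) ≠ 0 := by
    intro h
    apply hS
    have := sin_sq_add_cos_sq (θB - θA)
    have : sin (θB - θA) ^ 2 = 0 := by
      rw [eq_neg_of_add_eq_zero_right h] at this; linarith
    exact pow_eq_zero_iff (two_ne_zero) |>.1 this
  have hS' : sin θB * cos θA - cos θB * sin θA = sin (θB - θA) := (sin_sub θB θA).symm
  rw [bendOne, hS', div_eq_div_iff hS hC, primOne, primOne]
  have h1 := sin_sq_add_cos_sq (θB - θA)
  have h2 := sin_sq_add_cos_sq θB
  have h3 := cos_sub θB θA
  linear_combination g * (1 + cos (θB - θA)) * h2 + g * (1 + cos (θB - θA)) * h3 - g * h1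

theorem bendTwo_eq (κ : ℝ) {θA θB : ℝ} (hS : sin (θB - θA) ≠ 0) :
    bendTwo κ θA θB = κ * ((θB - θA) / sin (θB - θA) * sin θB - sin θA) := by
  have hS' : sin θB * cos θA - cos θB * sin θA = sin (θB - θA) := (sin_sub θB θA).symm
  rw [bendTwo, hS', div_eq_iff hS, primCos, primCos]
  have h2 := sin_sq_add_cos_sq θB
  have h3 := sin_sq_add_cos_sq θA
  field_simp
  rw [← hS']
  linear_combination κ * cos θB * (h2 - h3)

theorem primGreen_sub (θA θB : ℝ) (hS : sin (θB - θA) ≠ 0) :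
    primGreen θA θB θB - primGreen θA θB θA =
      (1 - cos (θB - θA)) * (1 - (θB - θA) / sin (θB - θA)) / 2 := by
  have hS' : sin θB * cos θA - cos θB * sin θA = sin (θB - θA) := (sin_sub θB θA).symm
  have h2 := sin_sq_add_cos_sq θB
  have h3 := sin_sq_add_cos_sq θA
  simp only [primGreen, primOne, hS']
  field_simp
  rw [← hS', cos_sub]
  generalize sin θA = sA at *
  generalize sin θB = sB at *
  generalize cos θA = cA at *
  generalize cos θB = cB at *
  clear hS hS'
  grind

theorem primCosSq_sub (θA θB : ℝ) :
    3 * (primCosSq θB θB - primCosSq θB θA) = 2 - cos θB ^ 2 -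
      2 * sin θA * cos θA * sin (θB - θA) - (2 - cos θA ^ 2) * cos (θB - θA) := by
  have h2 := sin_sq_add_cos_sq θB
  have h3 := sin_sq_add_cos_sq θA
  rw [sin_sub, cos_sub, primCosSq, primCosSq]
  generalize sin θA = sA at *
  generalize sin θB = sB at *
  generalize cos θA = cA at *
  generalize cos θB = cB at *
  grind

theorem bendThree_eq (g κ κ₃ : ℝ) {θA θB : ℝ} (hS : sin (θB - θA) ≠ 0) :
    bendThree g κ κ₃ θA θB =
      (κ * g * ((1 - cos (θB - θA)) * (1 - (θB - θA) / sin (θB - θA))) +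
        κ₃ * (2 - cos θB ^ 2 - 2 * sin θA * cos θA * sin (θB - θA) -
          (2 - cos θA ^ 2) * cos (θB - θA))) / sin (θB - θA) := by
  have hS' : sin θB * cos θA - cos θB * sin θA = sin (θB - θA) := (sin_sub θB θA).symm
  rw [bendThree, hS', primGreen_sub θA θB hS, ← primCosSq_sub]
  ring

/-- The coefficients of the impact parameter in terms of the polar angles of the end points. -/
theorem impact_coeff_of_bend {g κ κ₃ Φ sA cA sB cB S C k₁ k₂ k₃ q₁ q₂ q₃ : ℝ}
    (hA : sA ^ 2 + cA ^ 2 = 1) (hSC : S ^ 2 + C ^ 2 = 1) (hC : 1 + C ≠ 0)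
    (hS : S ≠ 0) (hsB : sB = sA * C + cA * S) (hcB : cB = cA * C - sA * S)
    (hk₁ : k₁ = g * S / (1 + C)) (hk₂ : k₂ = κ * (Φ / S * sB - sA))
    (hk₃ : k₃ = (κ * g * ((1 - C) * (1 - Φ / S)) +
      κ₃ * (2 - cB ^ 2 - 2 * sA * cA * S - (2 - cA ^ 2) * C)) / S)
    (h₁ : 2 * q₁ = 2 * (g * cA - sA * k₁))
    (h₂ : 2 * q₂ + q₁ ^ 2 = 2 * κ * cA ^ 2 - 2 * sA * k₂ - k₁ ^ 2)
    (h₃ : 2 * q₃ + 2 * q₁ * q₂ = 2 * κ₃ * cA ^ 3 - 2 * sA * k₃ - 2 * k₁ * k₂ +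
      k₁ ^ 2 * (2 * (g * cA - sA * k₁))) :
    q₁ = g * ((cA + cB) / (1 + C)) ∧
    q₂ = κ * (1 - sA * sB / S * Φ) - g ^ 2 * ((1 - sA * sB) / (1 + C)) ∧
    q₃ = (cA + cB) / (1 + C) * (κ₃ * (1 - sA * sB) -
      g * κ * (1 + (1 - C - sA * sB) / S * Φ) + g ^ 3 * ((2 - C - sA * sB) / (1 + C))) := by
  -- With `t` the half-angle tangent, `f = Φ / S` and `w = 1 + C`, everything becomes polynomial,
  -- subject to `w (1 + t²) = 2` and `sA² + cA² = 1`.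
  obtain ⟨t, rfl⟩ : ∃ t, S = t * (1 + C) := ⟨S / (1 + C), by field_simp⟩
  obtain ⟨f, rfl⟩ : ∃ f, Φ = f * (t * (1 + C)) := ⟨Φ / (t * (1 + C)), (div_mul_cancel₀ _ hS).symm⟩
  obtain ⟨w, rfl⟩ : ∃ w, C = w - 1 := ⟨C + 1, by ring⟩
  simp only [add_sub_cancel] at *
  have ht : t ≠ 0 := left_ne_zero_of_mul hS
  have hw : w * (1 + t ^ 2) = 2 := mul_left_cancel₀ hC (by linear_combination hSC)
  have hwi : w⁻¹ = (1 + t ^ 2) / 2 := by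
    rw [inv_eq_iff_eq_inv, inv_div, eq_div_iff (by positivity), hw]
  have hf : f * (t * w) / (t * w) = f := mul_div_cancel_right₀ _ hS
  have e₁ : k₁ = g * t := by rw [hk₁]; field_simp
  have e₂ : k₂ = κ * (f * sB - sA) := by rw [hk₂, hf]
  have e₃ : k₃ = κ * g * t * (1 - f) + κ₃ * (2 * t + cA ^ 2 * (w - 1) * t - sA ^ 2 * (t * w) -
      2 * sA * cA * (2 - w)) := by
    rw [hk₃, hf, div_eq_iff hS, hcB]
    linear_combination (-(κ * g * (1 - f)) - κ₃ * (2 + cA ^ 2 * (w - 1))) * hw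
  have hs : (cA + cB) / w = cA - sA * t := by
    rw [hcB]; field_simp; ring
  have hq₁ : q₁ = g * (cA - sA * t) := by rw [e₁] at h₁; linear_combination h₁ / 2
  have hSf : ∀ y, y / (t * w) * (f * (t * w)) = y * f := fun y => by field_simp
  have hq₂ : q₂ = κ * (1 - sA * sB * f) - g ^ 2 * ((1 - sA * sB) * ((1 + t ^ 2) / 2)) := by
    rw [e₂, e₁, hq₁] at h₂
    rw [hsB] at h₂ ⊢
    linear_combination h₂ / 2 + κ * hA +
      g ^ 2 * (-1 / 2 * hA - 1 / 2 * (sA ^ 2 + sA * cA * t) * hw)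
  refine ⟨by rw [hs, hq₁], ?_, ?_⟩
  · rw [hSf, div_eq_mul_inv _ w, hwi, hq₂]
  · rw [hSf, hs, div_eq_mul_inv _ w, hwi]
    rw [e₃, e₂, e₁, hq₁, hq₂] at h₃
    rw [hsB] at h₃ ⊢
    linear_combination h₃ / 2 + κ₃ * ((cA + sA * t) * hA - sA ^ 2 * cA * hw) -
      g * κ * f * cA * hw + g ^ 3 * (cA - sA * t) / 2 * hw

/-- Square the expansion of `b / d` and compare: a cubic polynomial that is `O(m⁴)` has zero
coefficients. -/
theorem eq_of_sq_expansion {d : ℝ} (hd : d ≠ 0) {b : ℝ → ℝ} {q₁ q₂ q₃ β₁ β₂ β₃ : ℝ}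
    (hb : HasOrder (𝓝[>] 0) (fun m => m) 4 fun m => b m / d -
      (1 + q₁ * (m / d) + q₂ * (m / d) ^ 2 + q₃ * (m / d) ^ 3))
    (hsq : HasOrder (𝓝[>] 0) (fun m => m) 4 fun m => (b m / d) ^ 2 -
      (1 + β₁ * (m / d) + β₂ * (m / d) ^ 2 + β₃ * (m / d) ^ 3)) :
    2 * q₁ = β₁ ∧ 2 * q₂ + q₁ ^ 2 = β₂ ∧ 2 * q₃ + 2 * q₁ * q₂ = β₃ := by
  have h1 : HasOrder (𝓝[>] 0) (fun m => m) 0 fun m => b m / d +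
      (1 + q₁ * (m / d) + q₂ * (m / d) ^ 2 + q₃ * (m / d) ^ 3) :=
    ((hb.weaken tendsto_id_nhdsGT_zero (n := 0) (by norm_num)).add (hasOrder_of_continuous
      (f := fun m => 2 * (1 + q₁ * (m / d) + q₂ * (m / d) ^ 2 + q₃ * (m / d) ^ 3))
      (by fun_prop))).congr_fun fun m => by ring
  have h2 : HasOrder (𝓝[>] 0) (fun m => m) 4 fun m => 0 + (2 * q₁ - β₁) / d * m +
      (2 * q₂ + q₁ ^ 2 - β₂) / d ^ 2 * m ^ 2 + (2 * q₃ + 2 * q₁ * q₂ - β₃) / d ^ 3 * m ^ 3 :=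
    ((hsq.sub (hb.mul h1)).sub (hasOrder_mul_pow (f := fun m => (q₂ ^ 2 + 2 * q₁ * q₃) / d ^ 4 +
      2 * q₂ * q₃ / d ^ 5 * m + q₃ ^ 2 / d ^ 6 * m ^ 2) (by fun_prop) 4)).congr_fun
      fun m => by ring
  obtain ⟨-, e1, e2, e3⟩ := cubic_coeff_eq_zero h2
  have hd2 : d ^ 2 ≠ 0 := pow_ne_zero 2 hd
  have hd3 : d ^ 3 ≠ 0 := pow_ne_zero 3 hd
  rw [div_eq_zero_iff, or_iff_left hd, sub_eq_zero] at e1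
  rw [div_eq_zero_iff, or_iff_left hd2, sub_eq_zero] at e2
  rw [div_eq_zero_iff, or_iff_left hd3, sub_eq_zero] at e3
  exact ⟨e1, e2, e3⟩

theorem AngularFamily.impact_coeff {g κ κ₃ θA θB d : ℝ} {θ ω u w P K : ℝ → ℝ → ℝ}
    {b v : ℝ → ℝ} (H : AngularFamily g κ κ₃ θA θB d θ ω u w P K b v) (hd : d ≠ 0)
    (hS : sin (θB - θA) ≠ 0) {q₁ q₂ q₃ : ℝ}
    (hb : HasOrder (𝓝[>] 0) (fun m => m) 4 fun m => b m / d -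
      (1 + q₁ * (m / d) + q₂ * (m / d) ^ 2 + q₃ * (m / d) ^ 3)) :
    q₁ = g * ((cos θA + cos θB) / (1 + cos (θB - θA))) ∧
    q₂ = κ * (1 - sin θA * sin θB / sin (θB - θA) * (θB - θA)) -
      g ^ 2 * ((1 - sin θA * sin θB) / (1 + cos (θB - θA))) ∧
    q₃ = (cos θA + cos θB) / (1 + cos (θB - θA)) * (κ₃ * (1 - sin θA * sin θB) -
      g * κ * (1 + (1 - cos (θB - θA) - sin θA * sin θB) / sin (θB - θA) * (θB - θA)) +
      g ^ 3 * ((2 - cos (θB - θA) - sin θA * sin θB) / (1 + cos (θB - θA)))) := by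
  have hS' : sin θB * cos θA - cos θB * sin θA ≠ 0 := by rwa [← sin_sub]
  have hSC := sin_sq_add_cos_sq (θB - θA)
  have hC : 1 + cos (θB - θA) ≠ 0 := by
    intro h
    rw [eq_neg_of_add_eq_zero_right h] at hSC
    exact hS (pow_eq_zero_iff two_ne_zero |>.1 (by linarith))
  obtain ⟨e1, e2, e3⟩ := eq_of_sq_expansion hd hb (H.expand_sq hd hS' rfl rfl rfl rfl)
  refine impact_coeff_of_bend (sin_sq_add_cos_sq θA) hSC hC hS ?_ ?_ (bendOne_eq g hS)
    (bendTwo_eq κ hS) (bendThree_eq g κ κ₃ hS) e1 e2 e3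
  · rw [← sin_add]; congr 1; ring
  · rw [← cos_add]; congr 1; ring

/-! ### Euclidean geometry of the end points. -/

theorem norm_dir {x : E3} (hx : x ≠ 0) : ‖dir x‖ = 1 := by
  rw [dir, norm_smul, norm_inv, norm_norm, inv_mul_cancel₀ (norm_ne_zero_iff.2 hx)]

theorem smul_dir (x : E3) : ‖x‖ • dir x = x := by
  rcases eq_or_ne x 0 with rfl | hx
  · simp [dir]
  · rw [dir, smul_inv_smul₀ (norm_ne_zero_iff.2 hx)]

theorem dir_smul_of_pos {c : ℝ} (hc : 0 < c) (x : E3) : dir (c • x) = dir x := by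
  rw [dir, dir, norm_smul, Real.norm_of_nonneg hc.le, smul_smul]
  congr 1
  field_simp

theorem dir_smul_of_neg {c : ℝ} (hc : c < 0) (x : E3) : dir (c • x) = -dir x := by
  rw [dir, dir, norm_smul, Real.norm_of_nonpos hc.le, smul_smul, ← neg_smul]
  congr 1
  have := hc.ne
  rw [mul_inv, mul_right_comm, inv_neg, neg_mul, inv_mul_cancel₀ this, neg_one_mul]

/-- Both sides are the distance from the origin to the line; Lagrange's identity for the cross
product reduces the equality of squares to algebra. -/
theorem rc_eq {xA xB : E3} (hA : xA ≠ 0) (hB : xB ≠ 0) (hAB : xB - xA ≠ 0) :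
    rc xA xB = ‖xA - inner ℝ xA (dir (xB - xA)) • dir (xB - xA)‖ := by
  have hD : ‖xB - xA‖ ≠ 0 := norm_ne_zero_iff.2 hAB
  have h1 : 0 ≤ rc xA xB := by unfold rc; positivity
  rw [← sq_eq_sq₀ h1 (norm_nonneg _)]
  have hN := norm_dir hAB
  set N := dir (xB - xA) with hNdef
  have hB' : xB = xA + ‖xB - xA‖ • N := by rw [hNdef, smul_dir]; abel
  have e1 : ‖xA - inner ℝ xA N • N‖ ^ 2 = ‖xA‖ ^ 2 - inner ℝ xA N ^ 2 := by
    rw [@norm_sub_sq_real, norm_smul, hN, inner_smul_right, Real.norm_eq_abs, mul_one, sq_abs]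
    ring
  have e2 : inner ℝ xA xB = ‖xA‖ ^ 2 + ‖xB - xA‖ * inner ℝ xA N := by
    conv_lhs => rw [hB']
    rw [inner_add_right, inner_smul_right, real_inner_self_eq_norm_sq]
  have e3 : ‖xB‖ ^ 2 = ‖xA‖ ^ 2 + 2 * ‖xB - xA‖ * inner ℝ xA N + ‖xB - xA‖ ^ 2 := by
    conv_lhs => rw [hB']
    rw [@norm_add_sq_real, norm_smul, hN, inner_smul_right, norm_norm]
    ring
  have nA : ‖xA‖ ≠ 0 := norm_ne_zero_iff.2 hA
  have nB : ‖xB‖ ≠ 0 := norm_ne_zero_iff.2 hB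
  have e4 : inner ℝ (dir xA) (dir xB) = inner ℝ xA xB / (‖xA‖ * ‖xB‖) := by
    simp only [dir, inner_smul_left, inner_smul_right, RCLike.conj_to_real]
    field_simp
  rw [e1, rc, mul_pow, norm_cross_sq, norm_dir hA, norm_dir hB, e4]
  have e5 : (‖xA‖ * ‖xB‖ / ‖xB - xA‖) ^ 2 *
      (1 ^ 2 * 1 ^ 2 - (inner ℝ xA xB / (‖xA‖ * ‖xB‖)) ^ 2) =
      (‖xA‖ ^ 2 * ‖xB‖ ^ 2 - inner ℝ xA xB ^ 2) / ‖xB - xA‖ ^ 2 := by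
    field_simp
  rw [e5, e2, e3]
  field_simp
  ring

/-- An orthonormal frame whose first vector is the direction of the line `xA xB` and whose second
vector points from the origin to this line. -/
theorem exists_frame {rh : ℝ} (hrh : 0 < rh) {xA xB : E3}
    (hseg : ∀ ξ ∈ Icc (0 : ℝ) 1, rh < ‖xA + ξ • (xB - xA)‖) (hne : dir xA ≠ dir xB) :
    0 < rc xA xB ∧ 0 < ‖xB - xA‖ ∧ ∃ (e : OrthonormalBasis (Fin 3) ℝ E3) (aA : ℝ),
      e 0 = dir (xB - xA) ∧ xA = aA • e 0 + rc xA xB • e 1 ∧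
      xB = (aA + ‖xB - xA‖) • e 0 + rc xA xB • e 1 := by
  have hA : xA ≠ 0 := by
    rintro rfl
    have := hseg 0 (by simp)
    simp at this; linarith
  have hB : xB ≠ 0 := by
    rintro rfl
    have := hseg 1 (by simp)
    simp at this; linarith
  have hAB : xB - xA ≠ 0 := fun h => hne (by rw [sub_eq_zero.1 h])
  have hD : 0 < ‖xB - xA‖ := norm_pos_iff.2 hAB
  have hrc := rc_eq hA hB hAB
  have hN := norm_dir hAB
  set N := dir (xB - xA) with hNdef
  set s := inner ℝ xA N with hs
  have hB' : xB = xA + ‖xB - xA‖ • N := by rw [hNdef, smul_dir]; abel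
  have hpos : 0 < rc xA xB := by
    rw [hrc, norm_pos_iff]
    -- If the line met the origin, the end points would lie either on the same side of it, making
    -- their directions equal, or on opposite sides, making the segment pass through it.
    intro h0
    have eA : xA = s • N := sub_eq_zero.1 h0
    have eB : xB = (s + ‖xB - xA‖) • N := by rw [add_smul, ← eA]; exact hB'
    have hs0 : s ≠ 0 := fun h => hA (by rw [eA, h, zero_smul])
    have hs1 : s + ‖xB - xA‖ ≠ 0 := fun h => hB (by rw [eB, h, zero_smul])
    rcases lt_or_gt_of_ne hs0 with h | h
    · rcases lt_or_gt_of_ne hs1 with h' | h'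
      · exact hne (by rw [eA, eB, dir_smul_of_neg h, dir_smul_of_neg h'])
      · have := hseg (-s / ‖xB - xA‖) ⟨div_nonneg (by linarith) hD.le,
          (div_le_one hD).2 (by linarith)⟩
        have e : xA + (-s / ‖xB - xA‖) • (xB - xA) = 0 := by
          have e1 : xB - xA = ‖xB - xA‖ • N := by rw [hNdef, smul_dir]
          rw [e1, norm_smul, norm_norm, hN, smul_smul, mul_one, div_mul_cancel₀ _ hD.ne', neg_smul]
          rw [← eA, add_neg_cancel]
        rw [e, norm_zero] at this
        linarith
    · exact hne (by rw [eA, eB, dir_smul_of_pos h, dir_smul_of_pos (by linarith)])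
  refine ⟨hpos, hD, ?_⟩
  set f := (rc xA xB)⁻¹ • (xA - s • N) with hf
  have hf1 : ‖f‖ = 1 := by
    rw [hf, norm_smul, norm_inv, Real.norm_of_nonneg hpos.le, hrc]
    exact inv_mul_cancel₀ (by rw [← hrc]; exact hpos.ne')
  have hfN : inner ℝ N f = 0 := by
    rw [hf, inner_smul_right, inner_sub_right, inner_smul_right, real_inner_self_eq_norm_sq, hN,
      real_inner_comm, ← hs]
    simp
  have hon : Orthonormal ℝ (({0, 1} : Set (Fin 3)).domRestrict ![N, f, 0]) := by
    constructor
    · rintro ⟨i, hi⟩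
      rcases hi with rfl | rfl
      · exact hN
      · exact hf1
    · rintro ⟨i, hi⟩ ⟨j, hj⟩ hij
      rcases hi with rfl | rfl <;> rcases hj with rfl | rfl
      · exact absurd rfl hij
      · exact hfN
      · exact (real_inner_comm _ _).trans hfN
      · exact absurd rfl hij
  obtain ⟨e, he⟩ := hon.exists_orthonormalBasis_extension_of_card_eq (by simp)
  have e0 : e 0 = N := by simpa using he 0 (by simp)
  have e1 : e 1 = f := by simpa using he 1 (by simp)
  have hxA : xA = s • N + rc xA xB • f := by
    rw [hf, smul_inv_smul₀ hpos.ne']; abel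
  refine ⟨e, s, e0, by rw [e0, e1]; exact hxA, ?_⟩
  rw [e0, e1, add_smul]
  calc xB = xA + ‖xB - xA‖ • N := hB'
    _ = (s • N + rc xA xB • f) + ‖xB - xA‖ • N := by rw [← hxA]
    _ = _ := by abel

theorem norm_of_frame (e : OrthonormalBasis (Fin 3) ℝ E3) (a d : ℝ) :
    ‖a • e 0 + d • e 1‖ = √(a ^ 2 + d ^ 2) := by
  rw [norm_eq_sqrt_real_inner, inner_eq_sum_frame e (a • e 0 + d • e 1)]
  congr 1
  simp [inner_add_left, inner_smul_left]
  ring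

theorem inner_frame (e : OrthonormalBasis (Fin 3) ℝ E3) (a d : ℝ) :
    inner ℝ (a • e 0 + d • e 1) (e 0) = a ∧ inner ℝ (a • e 0 + d • e 1) (e 1) = d ∧
      inner ℝ (a • e 0 + d • e 1) (e 2) = 0 := by
  refine ⟨?_, ?_, ?_⟩ <;> simp [inner_add_left, inner_smul_left]

theorem dir_frame (e : OrthonormalBasis (Fin 3) ℝ E3) (a : ℝ) {d : ℝ} (hd : 0 < d) :
    dir (a • e 0 + d • e 1) = sin (arctan (a / d)) • e 0 + cos (arctan (a / d)) • e 1 := by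
  rw [dir, norm_of_frame, sin_arctan_div hd, cos_arctan_div hd, smul_add, smul_smul, smul_smul,
    mul_comm a, mul_comm d]

theorem norm_cross_frame (e : OrthonormalBasis (Fin 3) ℝ E3) (a d a' d' : ℝ) :
    ‖cross (a • e 0 + d • e 1) (a' • e 0 + d' • e 1)‖ = |a' * d - d' * a| := by
  obtain ⟨h1, h2, h3⟩ := inner_frame e a d
  obtain ⟨h1', h2', h3'⟩ := inner_frame e a' d'
  rw [norm_cross_of_planar e h3 h3', h1, h2, h1', h2']

theorem inner_frame_frame (e : OrthonormalBasis (Fin 3) ℝ E3) (a d a' d' : ℝ) :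
    inner ℝ (a • e 0 + d • e 1) (a' • e 0 + d' • e 1) = a * a' + d * d' := by
  obtain ⟨h1, h2, h3⟩ := inner_frame e a d
  obtain ⟨h1', h2', h3'⟩ := inner_frame e a' d'
  rw [inner_eq_sum_frame e, h1, h2, h3, h1', h2', h3']
  ring

theorem inner_cross_dir_frame (e : OrthonormalBasis (Fin 3) ℝ E3) (a : ℝ) {d : ℝ} (hd : 0 < d) :
    inner ℝ (e 0) (dir (a • e 0 + d • e 1)) = sin (arctan (a / d)) ∧
      ‖cross (e 0) (dir (a • e 0 + d • e 1))‖ = cos (arctan (a / d)) := by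
  have h0 : e 0 = (1 : ℝ) • e 0 + (0 : ℝ) • e 1 := by simp
  rw [dir_frame e a hd]
  constructor
  · have h1 := inner_frame_frame e 1 0 (sin (arctan (a / d))) (cos (arctan (a / d)))
    rw [← h0] at h1
    rw [h1]; ring
  · have h1 := norm_cross_frame e 1 0 (sin (arctan (a / d))) (cos (arctan (a / d)))
    rw [← h0] at h1
    rw [h1, mul_zero, zero_sub, mul_one, abs_neg, abs_of_pos (cos_arctan_pos _)]

/-- Seen from the origin, the polar angles lie in `(-π/2, π/2)` and increase along the line. Their
difference is therefore in `(0, π)`, where `arccos` inverts `cos` and `sin` is positive. -/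
theorem inner_cross_dir_dir_frame (e : OrthonormalBasis (Fin 3) ℝ E3) {a a' d : ℝ} (hd : 0 < d)
    (ha : a < a') :
    0 < sin (arctan (a' / d) - arctan (a / d)) ∧
    inner ℝ (dir (a • e 0 + d • e 1)) (dir (a' • e 0 + d • e 1)) =
      cos (arctan (a' / d) - arctan (a / d)) ∧
    ‖cross (dir (a • e 0 + d • e 1)) (dir (a' • e 0 + d • e 1))‖ =
      sin (arctan (a' / d) - arctan (a / d)) ∧
    arccos (inner ℝ (dir (a • e 0 + d • e 1)) (dir (a' • e 0 + d • e 1))) =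
      arctan (a' / d) - arctan (a / d) := by
  have h0 : 0 < arctan (a' / d) - arctan (a / d) :=
    sub_pos.2 (arctan_strictMono (div_lt_div_of_pos_right ha hd))
  have h1 : arctan (a' / d) - arctan (a / d) < π := by
    linarith [arctan_lt_pi_div_two (a' / d), neg_pi_div_two_lt_arctan (a / d)]
  have hs := sin_pos_of_pos_of_lt_pi h0 h1
  have hi : inner ℝ (dir (a • e 0 + d • e 1)) (dir (a' • e 0 + d • e 1)) =
      cos (arctan (a' / d) - arctan (a / d)) := by
    rw [dir_frame e a hd, dir_frame e a' hd, inner_frame_frame, cos_sub]; ring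
  refine ⟨hs, hi, ?_, ?_⟩
  · rw [dir_frame e a hd, dir_frame e a' hd, norm_cross_frame, ← sin_sub, abs_of_pos hs]
  · rw [hi, arccos_cos h0.le h1.le]

/-! ### Rays for small mass and analyticity of the impact parameter. -/

/-- Confinement to `r > rh` makes `m / r` uniformly small, so local information on the potentials at
`0` holds along whole rays. -/
theorem eventually_forall_div {R : ℝ → Prop} (h : ∀ᶠ x in 𝓝 (0 : ℝ), R x) {rh : ℝ}
    (hrh : 0 < rh) : ∀ᶠ m in 𝓝[>] (0 : ℝ), ∀ r > rh, R (m / r) := by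
  obtain ⟨ε, hε, H⟩ := Metric.eventually_nhds_iff.1 h
  filter_upwards [Ioo_mem_nhdsGT (mul_pos hε hrh)] with m hm r hr
  refine H ?_
  have hr0 : 0 < r := hrh.trans hr
  rw [dist_zero_right, Real.norm_of_nonneg (div_nonneg hm.1.le hr0.le), div_lt_iff₀ hr0]
  exact hm.2.trans (mul_lt_mul_of_pos_left hr hε)

theorem covTime_isotropicMetric (P Q : ℝ → ℝ) (Γ : ℝ → Event) (ξ : ℝ) :
    covTime (isotropicMetric P Q) Γ ξ =
      P ‖(Γ ξ).2‖ * (derivWithin Γ (Icc 0 1) ξ).1 := by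
  simp [covTime, isotropicMetric]

theorem covSpace_isotropicMetric (P Q : ℝ → ℝ) (Γ : ℝ → Event) (ξ : ℝ) :
    covSpace (isotropicMetric P Q) Γ ξ =
      -(Q ‖(Γ ξ).2‖ • (derivWithin Γ (Icc 0 1) ξ).2) := by
  ext i
  simp [covSpace, isotropicMetric, EuclideanSpace.inner_single_right]

theorem analyticAt_and_eventually_eq_of_hasSum {c : ℕ → ℝ} {f : ℝ → ℝ} {ρ : ℝ} (hρ : 0 < ρ)
    (h : ∀ m ∈ Ioo 0 ρ, HasSum (fun n => c n * m ^ n) (f m)) :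
    ∃ F : ℝ → ℝ, AnalyticAt ℝ F 0 ∧ F 0 = c 0 ∧ ∀ m ∈ Ioo 0 ρ, f m = F m := by
  refine ⟨fun x => ∑' n, c n * x ^ n, analyticAt_tsum_mul_pow (half_pos hρ)
    (h (ρ / 2) ⟨by linarith, by linarith⟩).summable, ?_, fun m hm => (h m hm).tsum_eq.symm⟩
  change ∑' n, c n * (0 : ℝ) ^ n = c 0
  rw [tsum_eq_single 0 fun n hn => by simp [hn]]
  simp

/-- The initial tangent vector of a quasi-Minkowskian ray is analytic in the mass parameter. -/
theorem IsQuasiMinkowskianRay.initial {G : ℝ → Metric4} {rh x0A : ℝ} {xA xB : E3}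
    {Γ : ℝ → ℝ → Event} (h : IsQuasiMinkowskianRay G rh x0A xA xB Γ) :
    ∃ (T : ℝ → ℝ) (X : E3 → ℝ → ℝ), AnalyticAt ℝ T 0 ∧ (∀ y, AnalyticAt ℝ (X y) 0) ∧
      T 0 = ‖xB - xA‖ ∧ (∀ y, X y 0 = inner ℝ (xB - xA) y) ∧
      ∀ᶠ m in 𝓝[>] (0 : ℝ), (derivWithin (Γ m) (Icc 0 1) 0).1 = T m ∧
        (∀ y, inner ℝ (derivWithin (Γ m) (Icc 0 1) 0).2 y = X y m) ∧
        (Γ m 0).2 = xA ∧ (Γ m 1).2 = xB := by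
  obtain ⟨ρ, hρ, Y, hY0, hYn, hYd, hΓ⟩ := h
  have zero : (0 : ℝ) ∈ Icc (0 : ℝ) 1 := by simp
  have one : (1 : ℝ) ∈ Icc (0 : ℝ) 1 := by simp
  set D : ℕ → Event := fun n => derivWithin (Y n) (Icc 0 1) 0 with hD
  have hD0 : D 0 = (‖xB - xA‖, xB - xA) := by
    have h1 : HasDerivWithinAt (fun ξ : ℝ => ((x0A + ξ * ‖xB - xA‖, xA + ξ • (xB - xA)) : Event))
        (‖xB - xA‖, xB - xA) (Icc 0 1) 0 := by
      have e1 : HasDerivWithinAt (fun ξ : ℝ => x0A + ξ * ‖xB - xA‖) ‖xB - xA‖ (Icc 0 1) 0 := by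
        simpa using ((hasDerivWithinAt_id (0 : ℝ) (Icc 0 1)).mul_const ‖xB - xA‖).const_add x0A
      have e2 : HasDerivWithinAt (fun ξ : ℝ => xA + ξ • (xB - xA)) (xB - xA) (Icc 0 1) 0 := by
        simpa using ((hasDerivWithinAt_id (0 : ℝ) (Icc 0 1)).smul_const (xB - xA)).const_add xA
      exact e1.prodMk e2
    exact (h1.congr hY0 (hY0 0 zero)).derivWithin (uniqueDiffOn_Icc_zero_one 0 zero)
  have hsum : ∀ m ∈ Ioo 0 ρ, HasSum (fun n => m ^ n • D n) (derivWithin (Γ m) (Icc 0 1) 0) :=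
    fun m hm => ((hΓ m hm).1 0 zero).2.1
  obtain ⟨T, hT, hT0, hTm⟩ := analyticAt_and_eventually_eq_of_hasSum
    (c := fun n => (D n).1) hρ (f := fun m => (derivWithin (Γ m) (Icc 0 1) 0).1) fun m hm => by
      simpa [mul_comm] using (hsum m hm).mapL (ContinuousLinearMap.fst ℝ ℝ E3)
  have hX : ∀ y : E3, ∃ F : ℝ → ℝ, AnalyticAt ℝ F 0 ∧ F 0 = inner ℝ (D 0).2 y ∧
      ∀ m ∈ Ioo 0 ρ, inner ℝ (derivWithin (Γ m) (Icc 0 1) 0).2 y = F m := fun y =>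
    analyticAt_and_eventually_eq_of_hasSum (c := fun n => inner ℝ (D n).2 y) hρ
      (f := fun m => inner ℝ (derivWithin (Γ m) (Icc 0 1) 0).2 y) fun m hm => by
      have := (hsum m hm).mapL ((innerSL ℝ y).comp (ContinuousLinearMap.snd ℝ ℝ E3))
      simpa [mul_comm, real_inner_comm, inner_smul_left, inner_smul_right] using this
  choose X hXa hX0 hXm using hX
  refine ⟨T, X, hT, hXa, by rw [hT0, hD0], fun y => by rw [hX0, hD0], ?_⟩
  filter_upwards [Ioo_mem_nhdsGT hρ] with m hm
  refine ⟨hTm m hm, fun y => hXm y m hm, ?_, ?_⟩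
  -- The corrections vanish at the end points, so only the Minkowskian term survives there.
  · have h1 := (((hΓ m hm).1 0 zero).1).mapL (ContinuousLinearMap.snd ℝ ℝ E3)
    have h2 : HasSum (fun n => (ContinuousLinearMap.snd ℝ ℝ E3) (m ^ n • Y n 0)) _ :=
      hasSum_single 0 fun n hn => by
        rw [(hYn n (Nat.one_le_iff_ne_zero.2 hn)).1]; simp
    have h3 := h1.unique h2
    simpa [hY0 0 zero] using h3
  · have h1 := (((hΓ m hm).1 1 one).1).mapL (ContinuousLinearMap.snd ℝ ℝ E3)
    have h2 : HasSum (fun n => (ContinuousLinearMap.snd ℝ ℝ E3) (m ^ n • Y n 1)) _ :=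
      hasSum_single 0 fun n hn => by
        have := (hYn n (Nat.one_le_iff_ne_zero.2 hn)).2
        simp [this]
    have h3 := h1.unique h2
    simpa [hY0 1 one] using h3

theorem hasOrder_sub_of_analyticAt {f : ℝ → ℝ} {c : ℝ} (hf : AnalyticAt ℝ f 0) (hc : f 0 = c) :
    HasOrder (𝓝[>] 0) (fun m => m) 1 fun m => f m - c := by
  have h1 := (hf.differentiableAt.isBigO_sub).mono (nhdsWithin_le_nhds (s := Ioi (0 : ℝ)))
  simpa [HasOrder, hc] using h1

theorem analyticAt_comp_div_const {f : ℝ → ℝ} (hf : AnalyticAt ℝ f 0) (r : ℝ) :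
    AnalyticAt ℝ (fun m => f (m / r)) 0 := by
  have h1 : AnalyticAt ℝ (fun m : ℝ => m / r) 0 := by
    simp only [div_eq_mul_inv]; fun_prop
  exact AnalyticAt.comp_of_eq hf h1 (by simp)

/-- The family of rays in the plane frame, with its analytic impact parameter. -/
theorem IsQuasiMinkowskianRay.exists_angularFamily {FP FQ : ℝ → ℝ} {g κ κ₃ rh x0A d aA : ℝ}
    (hrh : 0 < rh) (hFP : AnalyticAt ℝ FP 0) (hFQ : AnalyticAt ℝ FQ 0) (hFP0 : FP 0 = 1)
    (hFQ0 : FQ 0 = 1)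
    (hV0 : (fun x => FQ x / FP x - (1 + 2 * g * x + 2 * κ * x ^ 2 + 2 * κ₃ * x ^ 3)) =O[𝓝 0]
      fun x => x ^ 4)
    (hV1 : (fun x => deriv (fun x => FQ x / FP x) x / 2 - (g + 2 * κ * x + 3 * κ₃ * x ^ 2))
      =O[𝓝 0] fun x => x ^ 3)
    {G : ℝ → Metric4}
    (hG : ∀ m, G m = isotropicMetric (fun r => FP (m / r)) (fun r => FQ (m / r)))
    {xA xB : E3} {Γ : ℝ → ℝ → Event} (h : IsQuasiMinkowskianRay G rh x0A xA xB Γ)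
    (hd : 0 < d) (hD : 0 < ‖xB - xA‖) (e : OrthonormalBasis (Fin 3) ℝ E3)
    (hA : xA = aA • e 0 + d • e 1) (hB : xB = (aA + ‖xB - xA‖) • e 0 + d • e 1) :
    ∃ b : ℝ → ℝ, AnalyticAt ℝ b 0 ∧ b 0 = d ∧
      (∀ᶠ m in 𝓝[>] (0 : ℝ), ∀ ξ ∈ Icc (0 : ℝ) 1, impactParameter (G m) (Γ m) ξ = b m) ∧
      ∃ (θ ω u w P K : ℝ → ℝ → ℝ) (v : ℝ → ℝ), AngularFamily g κ κ₃ (arctan (aA / d))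
        (arctan ((aA + ‖xB - xA‖) / d)) d θ ω u w P K b v := by
  have zero : (0 : ℝ) ∈ Icc (0 : ℝ) 1 := by simp
  have one : (1 : ℝ) ∈ Icc (0 : ℝ) 1 := by simp
  obtain ⟨T, X, hT, hX, hT0, hX0, hinit⟩ := h.initial
  set D := ‖xB - xA‖ with hDdef
  set rA := ‖xA‖ with hrA
  obtain ⟨iA0, iA1, iA2⟩ := inner_frame e aA d
  obtain ⟨iB0, iB1, iB2⟩ := inner_frame e (aA + D) d
  rw [← hA] at iA0 iA1 iA2
  rw [← hB] at iB0 iB1 iB2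
  have X00 : X (e 0) 0 = D := by rw [hX0, inner_sub_left, iA0, iB0]; ring
  have X10 : X (e 1) 0 = 0 := by rw [hX0, inner_sub_left, iA1, iB1]; ring
  have aP := analyticAt_comp_div_const hFP rA
  have aQ := analyticAt_comp_div_const hFQ rA
  have hX0a := hX (e 0)
  have hX1a := hX (e 1)
  set E : ℝ → ℝ := fun m => FP (m / rA) * T m with hE
  have aE : AnalyticAt ℝ E 0 := aP.mul hT
  have E0 : E 0 = D := by simp [hE, hFP0, hT0]
  have E0ne : E 0 ≠ 0 := by rw [E0]; exact hD.ne'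
  -- The moment per unit energy at `ξ = 0`, written through the analytic initial data; its value at
  -- `m = 0` is the distance `d`.
  set b : ℝ → ℝ := fun m => FQ (m / rA) * (X (e 0) m * d - X (e 1) m * aA) / E m with hb
  have ab : AnalyticAt ℝ b 0 := by
    exact (aQ.mul ((hX0a.mul analyticAt_const).sub (hX1a.mul analyticAt_const))).div aE E0ne
  have b0 : b 0 = d := by
    simp only [hb, zero_div, hFQ0, X00, X10, E0]; field_simp; ring
  have lim := fun {f : ℝ → ℝ} (hf : AnalyticAt ℝ f 0) =>
    hf.continuousAt.tendsto.mono_left (nhdsWithin_le_nhds (s := Ioi (0 : ℝ)))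
  have hEpos : ∀ᶠ m in 𝓝[>] (0 : ℝ), 0 < E m := (lim aE).eventually_const_lt (by rwa [E0])
  have hbpos : ∀ᶠ m in 𝓝[>] (0 : ℝ), 0 < b m := (lim ab).eventually_const_lt (by rwa [b0])
  have hPpos : ∀ᶠ x in 𝓝 (0 : ℝ), 0 < FP x :=
    hFP.continuousAt.tendsto.eventually_const_lt (by rw [hFP0]; norm_num)
  have hQpos : ∀ᶠ x in 𝓝 (0 : ℝ), 1 / 2 < FQ x :=
    hFQ.continuousAt.tendsto.eventually_const_lt (by rw [hFQ0]; norm_num)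
  have hPd : ∀ᶠ x in 𝓝 (0 : ℝ), DifferentiableAt ℝ FP x :=
    hFP.eventually_analyticAt.mono fun x hx => hx.differentiableAt
  have hQd : ∀ᶠ x in 𝓝 (0 : ℝ), DifferentiableAt ℝ FQ x :=
    hFQ.eventually_analyticAt.mono fun x hx => hx.differentiableAt
  have hVd : ∀ᶠ x in 𝓝 (0 : ℝ), DifferentiableAt ℝ (fun x => FQ x / FP x) x := by
    filter_upwards [hPd, hQd, hPpos] with x h1 h2 h3 using h2.div h1 h3.ne'
  have hgood := eventually_forall_div ((hPpos.and hQpos).and (hPd.and hQd)) hrh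
  have hgeo : ∀ᶠ m in 𝓝[>] (0 : ℝ), (∀ ξ ∈ Icc (0 : ℝ) 1, rh < ‖(Γ m ξ).2‖) ∧
      IsNullGeodesicOn (isotropicMetric (fun r => FP (m / r)) (fun r => FQ (m / r))) (Γ m)
        (Icc 0 1) := by
    obtain ⟨ρ, hρ, Y, -, -, -, hΓ⟩ := h
    filter_upwards [Ioo_mem_nhdsGT hρ] with m hm
    exact ⟨fun ξ hξ => ((hΓ m hm).1 ξ hξ).2.2, by rw [← hG]; exact (hΓ m hm).2⟩
  set σ : ℝ → ℝ → ℝ := fun m ξ => E m / FQ (m / ‖(Γ m ξ).2‖) with hσ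
  set l : ℝ → ℝ → E3 := fun m ξ => (FQ (m / ‖(Γ m ξ).2‖) / E m) •
    (derivWithin (Γ m) (Icc 0 1) ξ).2 with hl
  have hE_eq : ∀ᶠ m in 𝓝[>] (0 : ℝ), covTime (isotropicMetric (fun r => FP (m / r))
      (fun r => FQ (m / r))) (Γ m) 0 = E m := by
    filter_upwards [hinit] with m hm
    rw [covTime_isotropicMetric, hm.1, hm.2.2.1]
  have hdiff : ∀ m r, r ≠ 0 → DifferentiableAt ℝ (fun r : ℝ => m / r) r := fun m r hr =>
    (differentiableAt_const m).div differentiableAt_id hr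
  have hregular : ∀ᶠ m in 𝓝[>] (0 : ℝ), ∀ ξ ∈ Icc (0 : ℝ) 1, (Γ m ξ).2 ≠ 0 ∧
      DifferentiableAt ℝ (fun r => FP (m / r)) ‖(Γ m ξ).2‖ ∧
      DifferentiableAt ℝ (fun r => FQ (m / r)) ‖(Γ m ξ).2‖ ∧ 0 < FP (m / ‖(Γ m ξ).2‖) ∧
      1 / 2 < FQ (m / ‖(Γ m ξ).2‖) := by
    filter_upwards [hgood, hgeo] with m h1 h2 ξ hξ
    have h3 := h2.1 ξ hξ
    have h4 : ‖(Γ m ξ).2‖ ≠ 0 := (hrh.trans h3).ne'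
    obtain ⟨⟨p1, p2⟩, p3, p4⟩ := h1 _ h3
    exact ⟨norm_ne_zero_iff.1 h4, p3.comp _ (hdiff m _ h4), p4.comp _ (hdiff m _ h4), p1, p2⟩
  have hopt : ∀ᶠ m in 𝓝[>] (0 : ℝ), IsOpticalRay (fun r => FQ (m / r) / FP (m / r)) (σ m)
      (fun ξ => (Γ m ξ).2) (l m) := by
    filter_upwards [hregular, hgeo, hE_eq, hEpos] with m h1 h2 h3 h4
    have := isOpticalRay_of_isNullGeodesicOn h2.2 (fun ξ hξ => (h1 ξ hξ).1)
      (fun ξ hξ => (h1 ξ hξ).2.1) (fun ξ hξ => (h1 ξ hξ).2.2.1)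
      (fun ξ hξ => (h1 ξ hξ).2.2.2.1.ne')
      (fun ξ hξ => ((by norm_num : (0 : ℝ) < 1 / 2).trans (h1 ξ hξ).2.2.2.2).ne')
      (by rw [h3]; exact h4.ne')
    rw [h3] at this
    exact this
  have hl0 : ∀ᶠ m in 𝓝[>] (0 : ℝ), ∀ y, inner ℝ (l m 0) y = FQ (m / rA) * X y m / E m := by
    filter_upwards [hinit] with m hm y
    simp only [hl, inner_smul_left, RCLike.conj_to_real, hm.2.1 y, hm.2.2.1]
    ring
  have hJ : ∀ᶠ m in 𝓝[>] (0 : ℝ), inner ℝ (l m 0) (e 0) * inner ℝ (Γ m 0).2 (e 1) -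
      inner ℝ (l m 0) (e 1) * inner ℝ (Γ m 0).2 (e 0) = b m := by
    filter_upwards [hinit, hl0] with m h1 h2
    rw [h2, h2, h1.2.2.1, iA0, iA1]
    simp only [hb]; ring
  have hplanar : ∀ᶠ m in 𝓝[>] (0 : ℝ), ∀ ξ ∈ Icc (0 : ℝ) 1,
      inner ℝ (Γ m ξ).2 (e 2) = 0 ∧ inner ℝ (l m ξ) (e 2) = 0 := by
    filter_upwards [hopt, hJ, hbpos, hinit] with m h1 h2 h3 h4 ξ hξ
    obtain ⟨-, -, h5, h6⟩ := h4
    refine h1.planar e hd.ne' ?_ ?_ ?_ ?_ ?_ ?_ hξ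
    · simp only [h5, iA1]
    · simp only [h6, iB1]
    · simp only [h5, iA2]
    · simp only [h6, iB2]
    · simp only [h5, h6, iA0, iB0]; linarith
    · rw [h5, iA1] at h2
      simp only [h5]
      rw [h2]; exact h3.ne'
  have hplane : ∀ᶠ m in 𝓝[>] (0 : ℝ), IsPlaneRay (fun r => FQ (m / r) / FP (m / r)) (σ m)
      (fun ξ => inner ℝ (Γ m ξ).2 (e 0)) (fun ξ => inner ℝ (Γ m ξ).2 (e 1))
      (fun ξ => inner ℝ (l m ξ) (e 0)) (fun ξ => inner ℝ (l m ξ) (e 1)) (b m) := by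
    filter_upwards [hopt, hplanar, hJ] with m h1 h2 h3
    rw [← h3]
    exact h1.isPlaneRay e h2
  refine ⟨b, ab, b0, ?_, _, _, _, _, _, _, _, angularFamily_of_isPlaneRay hd hrh hVd hV0 hV1
    hplane ?_ ?_ (hasOrder_sub_of_analyticAt ab b0) ?_ ?_ ?_ ?_ ?_⟩
  · filter_upwards [hplane, hplanar, hregular, hgeo, hE_eq, hEpos, hbpos]
      with m h1 h2 h3 h4 h5 h6 h7 ξ hξ
    have hc := covTime_eq_of_isNullGeodesicOn h4.2 (fun ξ hξ => (h3 ξ hξ).1)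
      (fun ξ hξ => (h3 ξ hξ).2.1) (fun ξ hξ => (h3 ξ hξ).2.2.1) hξ
    have hs : covSpace (isotropicMetric (fun r => FP (m / r)) (fun r => FQ (m / r))) (Γ m) ξ =
        (-E m) • l m ξ := by
      rw [covSpace_isotropicMetric, hl]
      simp only [smul_smul, neg_mul, neg_smul]
      rw [mul_div_cancel₀ _ h6.ne']
    have hi : ∀ y, inner ℝ ((-E m) • l m ξ) y = -E m * inner ℝ (l m ξ) y := fun y => by
      rw [inner_smul_left]; simp
    rw [hG, impactParameter, hc, h5, hs, norm_cross_of_planar e (h2 ξ hξ).1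
      (by rw [hi, (h2 ξ hξ).2, mul_zero]), hi, hi]
    have hm := h1.moment ξ hξ
    have e1 : -E m * inner ℝ (l m ξ) (e 0) * inner ℝ (Γ m ξ).2 (e 1) -
        -E m * inner ℝ (l m ξ) (e 1) * inner ℝ (Γ m ξ).2 (e 0) = -(E m * b m) := by
      rw [← hm]; ring
    rw [e1, abs_neg, abs_of_pos (mul_pos h6 h7), mul_div_cancel_left₀ _ h6.ne']
  · filter_upwards [hgeo, hplanar] with m h1 h2 ξ hξ
    have h3 := h1.1 ξ hξ
    rw [norm_eq_sqrt_real_inner, inner_eq_sum_frame e (Γ m ξ).2 (Γ m ξ).2, (h2 ξ hξ).1] at h3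
    convert h3 using 2
    ring
  -- The speed factor is `E / FQ`, with `E` bounded and `FQ > 1/2`.
  · obtain ⟨C, hC⟩ := (((hasOrder_sub_of_analyticAt aE E0).weaken tendsto_id_nhdsGT_zero
      (n := 0) (by norm_num)).add (hasOrder_const D)).exists_bound
    refine hasOrder_of_le (C * 2) (eventually_rayFilter (r := fun m ξ => |σ m ξ| ≤ C * 2) |>.2 ?_)
    filter_upwards [hC, hregular] with m h1 h2 ξ hξ
    have h3 := (h2 ξ hξ).2.2.2.2
    rw [sub_add_cancel] at h1
    simp only [hσ]
    rw [abs_div, abs_of_pos ((by norm_num : (0 : ℝ) < 1 / 2).trans h3),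
      div_le_iff₀ ((by norm_num : (0 : ℝ) < 1 / 2).trans h3)]
    have : 0 ≤ C := (abs_nonneg _).trans h1
    nlinarith
  · have ak : AnalyticAt ℝ (fun m => FQ (m / rA) * X (e 1) m / E m) 0 :=
      (aQ.mul hX1a).div aE E0ne
    refine (hasOrder_sub_of_analyticAt ak (c := 0) (by simp [X10])).congr ?_
    filter_upwards [hl0] with m hm
    rw [hm, sub_zero]
  · filter_upwards [hinit] with m hm
    rw [hm.2.2.1, iA0]
  · filter_upwards [hinit] with m hm
    rw [hm.2.2.2, iB0]
  · filter_upwards [hinit] with m hm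
    rw [hm.2.2.1, iA1]
  · filter_upwards [hinit] with m hm
    rw [hm.2.2.2, iB1]

/-- The two potentials are kept arbitrary near `0`, so that one argument serves the metric and its
conformal partner; the coefficients depend only on the quotient. -/
theorem exists_impact_series {FP FQ : ℝ → ℝ} {g κ κ₃ rh x0A : ℝ}
    (hrh : 0 < rh) (hFP : AnalyticAt ℝ FP 0) (hFQ : AnalyticAt ℝ FQ 0) (hFP0 : FP 0 = 1)
    (hFQ0 : FQ 0 = 1)
    (hV0 : (fun x => FQ x / FP x - (1 + 2 * g * x + 2 * κ * x ^ 2 + 2 * κ₃ * x ^ 3)) =O[𝓝 0]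
      fun x => x ^ 4)
    (hV1 : (fun x => deriv (fun x => FQ x / FP x) x / 2 - (g + 2 * κ * x + 3 * κ₃ * x ^ 2))
      =O[𝓝 0] fun x => x ^ 3)
    {G : ℝ → Metric4}
    (hG : ∀ m, G m = isotropicMetric (fun r => FP (m / r)) (fun r => FQ (m / r)))
    {xA xB : E3} (hseg : ∀ ξ ∈ Icc (0 : ℝ) 1, rh < ‖xA + ξ • (xB - xA)‖)
    {nA nB N : E3} (hnA : nA = dir xA) (hnB : nB = dir xB) (hN : N = dir (xB - xA))
    (hne : nA ≠ nB) {Γ : ℝ → ℝ → Event} (h : IsQuasiMinkowskianRay G rh x0A xA xB Γ) :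
    ∃ q : ℕ → ℝ,
      (∀ᶠ m in 𝓝[>] (0 : ℝ), ∀ ξ ∈ Icc (0 : ℝ) 1,
        HasSum (fun n => rc xA xB * ((m / rc xA xB) ^ n * q n))
          (impactParameter (G m) (Γ m) ξ)) ∧
      q 0 = 1 ∧
      q 1 = g * ((‖cross N nA‖ + ‖cross N nB‖) / (1 + inner ℝ nA nB)) ∧
      q 2 = κ * (1 - inner ℝ N nA * inner ℝ N nB / ‖cross nA nB‖ * arccos (inner ℝ nA nB))
            - g ^ 2 * ((1 - inner ℝ N nA * inner ℝ N nB) / (1 + inner ℝ nA nB)) ∧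
      q 3 = (‖cross N nA‖ + ‖cross N nB‖) / (1 + inner ℝ nA nB) *
            (κ₃ * (1 - inner ℝ N nA * inner ℝ N nB)
              - g * κ * (1 + (1 - inner ℝ nA nB - inner ℝ N nA * inner ℝ N nB) / ‖cross nA nB‖ *
                  arccos (inner ℝ nA nB))
              + g ^ 3 * ((2 - inner ℝ nA nB - inner ℝ N nA * inner ℝ N nB) /
                  (1 + inner ℝ nA nB))) := by
  rw [hnA, hnB] at hne
  obtain ⟨hd, hD, e, aA, he0, hA, hB⟩ := exists_frame hrh hseg hne
  obtain ⟨b, hb, hb0, himp, θ, ω, u, w, P, K, v, H⟩ :=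
    h.exists_angularFamily hrh hFP hFQ hFP0 hFQ0 hV0 hV1 hG hd hD e hA hB
  obtain ⟨c, hc, hcO⟩ := exists_cubic_remainder hb
  set d := rc xA xB with hdd
  have hd' := hd.ne'
  have hc0 : c 0 = d := by
    rw [← hb0]
    have h1 := hc.self_of_nhds
    refine HasSum.unique ?_ h1
    simpa using hasSum_single (f := fun n => c n * (0 : ℝ) ^ n) 0 fun n hn => by simp [hn]
  obtain ⟨hS, hi, hcr, hac⟩ := inner_cross_dir_dir_frame e hd
    (show aA < aA + ‖xB - xA‖ by linarith)
  obtain ⟨hNA, hNA'⟩ := inner_cross_dir_frame e aA hd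
  obtain ⟨hNB, hNB'⟩ := inner_cross_dir_frame e (aA + ‖xB - xA‖) hd
  rw [← hA] at hi hcr hac hNA hNA'
  rw [← hB] at hi hcr hac hNB hNB'
  rw [he0, ← hN] at hNA hNA' hNB hNB'
  rw [← hnA] at hi hcr hac hNA hNA'
  rw [← hnB] at hi hcr hac hNB hNB'
  -- Passing from powers of `m` to powers of `m / d`, with `d` factored out, turns the coefficient
  -- `c n` into `c n * d ^ n / d`.
  have key := H.impact_coeff hd' hS.ne' (q₁ := c 1) (q₂ := c 2 * d) (q₃ := c 3 * d ^ 2) (by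
    have h1 : HasOrder (𝓝[>] 0) (fun m : ℝ => m) 4 fun x =>
        b x - (c 0 + c 1 * x + c 2 * x ^ 2 + c 3 * x ^ 3) := hcO.mono nhdsWithin_le_nhds
    refine (h1.const_mul d⁻¹).congr_fun fun m => ?_
    rw [hc0]; field_simp)
  rw [← hNA, ← hNB, ← hNA', ← hNB', ← hcr, ← hi, ← hac] at key
  refine ⟨fun n => c n * d ^ n / d, ?_, by simp [hc0, hd'], ?_, ?_, ?_⟩
  · filter_upwards [himp, hc.filter_mono nhdsWithin_le_nhds] with m h1 h2 ξ hξ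
    rw [h1 ξ hξ]
    have e1 : (fun n => d * ((m / d) ^ n * (c n * d ^ n / d))) = fun n => c n * m ^ n := by
      funext n
      rw [div_pow]; field_simp
    rw [e1]
    exact h2
  · rw [← key.1]; field_simp
  · rw [← key.2.1]; field_simp
  · rw [← key.2.2]; field_simp

end LightRay

theorem proposition7 (p : LightRay.Params) (m₀ rh : ℝ) (hm₀ : 0 < m₀) (hrh : 0 < rh)
    (hA : ∀ r > rh, Summable (fun n => p.coeffA n * (m₀ / r) ^ n) ∧ 0 < p.potA m₀ r)
    (hB : ∀ r > rh, Summable (fun n => p.coeffB n * (m₀ / r) ^ n) ∧ 0 < p.potBinv m₀ r)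
    (g : ℝ → LightRay.Metric4) (hg : g = p.metric ∨ g = p.conformalMetric)
    (xA xB : LightRay.E3)
    (hseg : ∀ ξ ∈ Set.Icc (0 : ℝ) 1, rh < ‖xA + ξ • (xB - xA)‖)
    (nA nB N : LightRay.E3) (hnA : nA = LightRay.dir xA) (hnB : nB = LightRay.dir xB)
    (hN : N = LightRay.dir (xB - xA)) (hne : nA ≠ nB)
    (x0A : ℝ) (Γ : ℝ → ℝ → LightRay.Event)
    (hΓ : LightRay.IsQuasiMinkowskianRay g rh x0A xA xB Γ) :
    ∃ q : ℕ → ℝ,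
      (∀ᶠ m in 𝓝[>] (0 : ℝ), ∀ ξ ∈ Set.Icc (0 : ℝ) 1,
        HasSum (fun n => LightRay.rc xA xB * ((m / LightRay.rc xA xB) ^ n * q n))
          (LightRay.impactParameter (g m) (Γ m) ξ)) ∧
      q 0 = 1 ∧
      q 1 = (1 + p.γ) * ((‖LightRay.cross N nA‖ + ‖LightRay.cross N nB‖) / (1 + inner ℝ nA nB)) ∧
      q 2 = p.kappa * (1 - inner ℝ N nA * inner ℝ N nB / ‖LightRay.cross nA nB‖ *
              Real.arccos (inner ℝ nA nB))
            - (1 + p.γ) ^ 2 * ((1 - inner ℝ N nA * inner ℝ N nB) / (1 + inner ℝ nA nB)) ∧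
      q 3 = (‖LightRay.cross N nA‖ + ‖LightRay.cross N nB‖) / (1 + inner ℝ nA nB) *
            (p.kappa3 * (1 - inner ℝ N nA * inner ℝ N nB)
              - (1 + p.γ) * p.kappa *
                (1 + (1 - inner ℝ nA nB - inner ℝ N nA * inner ℝ N nB) / ‖LightRay.cross nA nB‖ *
                  Real.arccos (inner ℝ nA nB))
              + (1 + p.γ) ^ 3 *
                ((2 - inner ℝ nA nB - inner ℝ N nA * inner ℝ N nB) / (1 + inner ℝ nA nB))) := by
  -- Any radius beyond `rh` would do: convergence at one positive value of `m / r` makes both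
  -- potentials analytic at `0`.
  have hx₀ : 0 < m₀ / (2 * rh) := by positivity
  have sA := (hA (2 * rh) (by linarith)).1
  have sB := (hB (2 * rh) (by linarith)).1
  have aA := LightRay.analyticAt_tsum_mul_pow hx₀ sA
  have aB := LightRay.analyticAt_tsum_mul_pow hx₀ sB
  have A0 : ∑' n, p.coeffA n * (0 : ℝ) ^ n = 1 := by
    rw [tsum_eq_single 0 fun n hn => by simp [hn]]; simp [LightRay.Params.coeffA]
  have B0 : ∑' n, p.coeffB n * (0 : ℝ) ^ n = 1 := by
    rw [tsum_eq_single 0 fun n hn => by simp [hn]]; simp [LightRay.Params.coeffB]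
  have h0 := p.optical_isBigO hx₀ sA sB
  have h1 := p.deriv_optical_isBigO hx₀ sA sB
  rcases hg with rfl | rfl
  · exact LightRay.exists_impact_series hrh aA aB A0 B0 h0 h1 (fun m => rfl) hseg hnA hnB hN hne hΓ
  -- For the conformal metric the time potential is `1` and the space potential is the index itself,
  -- so the quotient is unchanged.
  · have aO : AnalyticAt ℝ p.optical 0 := aB.div aA (by rw [A0]; norm_num)
    have O0 : p.optical 0 = 1 := by rw [LightRay.Params.optical, A0, B0, div_one]
    have e1 : (fun x => p.optical x / (fun _ : ℝ => (1 : ℝ)) x) = p.optical := by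
      funext x; exact div_one _
    refine LightRay.exists_impact_series hrh (FP := fun _ => 1) (FQ := p.optical) analyticAt_const aO rfl O0
      ?_ ?_ (fun m => rfl) hseg hnA hnB hN hne hΓ
    · simpa only [div_one] using h0
    · rw [e1]; exact h1
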